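/- **Setting.** Let $p\ge 1$, $K\ge 0$ be integers and $\theta=(K,A,\beta,\Sigma_Z,\Sigma_W,\sigma^2)$ with $A\in\mathbb R^{p\times K}$, $\beta\in\mathbb R^K$. A mean zero random variable $x$ is $\gamma$ sub-Gaussian if $\mathbb E[e^{tx}]\le e^{t^2\gamma^2/2}$ for all $t\in\mathbb R$; a mean zero random vector $x$ is $\gamma$ sub-Gaussian if $\langle x,v\rangle$ is, for every unit vector $v$. The pair $(X,Y)\in\mathbb R^p\times\mathbb R$ follows the sub-Gaussian factor regression model sG-FRM$(\theta)$ with constants $\gamma_z,\gamma_w,\gamma_\varepsilon$ if $X=AZ+W$ and $Y=Z^\top\beta+\varepsilon$ with mutually independent, mean zero $Z\in\mathbb R^K$, $W\in\mathbb R^p$, $\varepsilon\in\mathbb R$ such that $\mathbb E[ZZ^\top]=\Sigma_Z$, $\mathbb E[WW^\top]=\Sigma_W$, $\mathbb E[\varepsilon^2]=\sigma^2$, $\operatorname{rank}(A)=\operatorname{rank}(\Sigma_Z)=K$, and if $\varepsilon$ is $\sigma\gamma_\varepsilon$ sub-Gaussian, $Z=\Sigma_Z^{1/2}\widetilde Z$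 and $W=\Sigma_W^{1/2}\widetilde W$ with $\widetilde Z$ being $\gamma_z$ sub-Gaussian, $\widetilde W$ being $\gamma_w$ sub-Gaussian, $\mathbb E[\widetilde Z\widetilde Z^\top]=I_K$ and $\mathbb E[\widetilde W\widetilde W^\top]=I_p$. Let $\boldsymbol X\in\mathbb R^{n\times p}$, $n\ge1$, have as rows the $X$-parts $X_i=AZ_i+W_i$ of $n$ independent copies of $(X,Y)$, generated by independent copies $(Z_i,W_i,\varepsilon_i)$ of $(Z,W,\varepsilon)$. Let $\sigma_1(\boldsymbol X)\ge\sigma_2(\boldsymbol X)\ge\cdots$ be its singular values (zero beyond $n\wedge p$), $\widehat\lambda_k=\sigma_k^2(\boldsymbol X)/n$ for $k\ge1$, $\widehat\lambda_0=\infty$, and let $\boldsymbol X_{(k)}$ be the best rank $k$ approximation of $\boldsymbol X$ (its singular value decomposition truncated after $k$ terms). For $\mu_n>0$ and $\kappa>1$ let $$\widetilde s\in\arg\min_{0\le k\le\bar K}\frac{\|\boldsymbol X-\boldsymbol X_{(k)}\|_F^2}{np-\mu_nk},\qquad \bar K=\Big\lfloor\frac{\kappa}{1+\kappa}\frac{np}{\mu_n}\Big\rfloor\wedge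 n\wedge p .$$ Let $r_e(\Sigma_W)=\operatorname{tr}(\Sigma_W)/\|\Sigma_W\|_{\rm op}$, where $\Sigma_W\ne0$, and $\delta_W=c_\delta\big(\|\Sigma_W\|_{\rm op}+\operatorname{tr}(\Sigma_W)/n\big)$ with a constant $c_\delta>0$. **Proposition 2.** For all $\gamma_w>0$ and $c'>0$ there is $\underline c_0=\underline c_0(\gamma_w,c')>0$ such that for every $c_0\ge\underline c_0$, $\kappa>1$, $c>0$ and $c_\delta>0$ there are constants $a,b,C>0$, depending only on $\gamma_w,c',c_0,\kappa,c,c_\delta$, with the following property. Put $\mu_n=c_0(n+p)$. For all $n,p\ge1$ and every $\theta$ such that $(X,Y)$ follows sG-FRM$(\theta)$ with constants $\gamma_z,\gamma_w,\gamma_\varepsilon$ (for any $\gamma_z,\gamma_\varepsilon$), $\log p\le cn$, $K\le\bar K$ and $r_e(\Sigma_W)\ge c'(n\wedge p)$, $$\mathbb P_\theta\Big\{\widetilde s\le K,\quad \widehat\lambda_{\widetilde s}\ge a\,\delta_W,\quad \widehat\lambda_{\widetilde s+1}\le b\,\delta_W\Big\}\ge 1-\frac{C}{n},$$ where, if the minimizer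 $\widetilde s$ is not unique, the event requires the three properties of every minimizer. -/

import Mathlib

open MeasureTheory ProbabilityTheory
open scoped NNReal Matrix

namespace FactorRegression

/-- Operator norm `‖M‖_op` (with respect to the Euclidean norms), i.e. the largest singular value. -/
noncomputable def opNorm {m q : ℕ} (M : Matrix (Fin m) (Fin q) ℝ) : ℝ :=
  ‖(Matrix.toEuclideanLin M).toContinuousLinearMap‖

/-- Squared Frobenius norm `‖M‖_F²`. -/
noncomputable def frobSq {m q : ℕ} (M : Matrix (Fin m) (Fin q) ℝ) : ℝ :=
  ∑ i, ∑ j, M i j ^ 2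

open scoped MatrixOrder Matrix.Norms.L2Operator in
/-- The positive semi-definite square root `S^{1/2}` of a positive semi-definite matrix. -/
noncomputable def matSqrt {q : ℕ} (S : Matrix (Fin q) (Fin q) ℝ) : Matrix (Fin q) (Fin q) ℝ :=
  CFC.sqrt S

/-- The effective rank `r_e(S) = tr(S) / ‖S‖_op`. -/
noncomputable def effRank {p : ℕ} (S : Matrix (Fin p) (Fin p) ℝ) : ℝ :=
  S.trace / opNorm S

/-- The noise level `δ_W = c (‖Σ_W‖_op + tr(Σ_W) / n)`. -/
noncomputable def deltaW {p : ℕ} (c : ℝ) (n : ℕ) (S : Matrix (Fin p) (Fin p) ℝ) : ℝ :=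
  c * (opNorm S + S.trace / n)

/-! ### The sub-Gaussian factor regression model -/

/-- The parameter `θ = (K, A, β, Σ_Z, Σ_W, σ²)`. -/
structure Param (p K : ℕ) where
  A : Matrix (Fin p) (Fin K) ℝ
  β : Fin K → ℝ
  SigmaZ : Matrix (Fin K) (Fin K) ℝ
  SigmaW : Matrix (Fin p) (Fin p) ℝ
  σ : ℝ≥0

/-- A mean zero random vector `x` is `γ` sub-Gaussian if
`E exp(t⟨v, x⟩) ≤ exp(t²γ²/2)` for all real `t` and all unit vectors `v`. -/
structure IsSubGaussianVector {Ω : Type*} [MeasurableSpace Ω] (P : Measure Ω) {q : ℕ}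
    (x : Ω → Fin q → ℝ) (γ : ℝ≥0) : Prop where
  measurable : Measurable x
  mean_zero : ∀ j, ∫ ω, x ω j ∂P = 0
  subGaussian : ∀ v : Fin q → ℝ, v ⬝ᵥ v = 1 → HasSubgaussianMGF (fun ω => v ⬝ᵥ x ω) (γ ^ 2) P

/-- The pair `(X, Y)` follows the factor regression model with parameter `θ`, the latent
variables being `(Z, W, ε)`. -/
structure IsFRM {Ω : Type*} [MeasurableSpace Ω] (P : Measure Ω) {p K : ℕ} (θ : Param p K)
    (Z : Ω → Fin K → ℝ) (W : Ω → Fin p → ℝ) (ε : Ω → ℝ)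
    (X : Ω → Fin p → ℝ) (Y : Ω → ℝ) : Prop where
  measurable_Z : Measurable Z
  measurable_W : Measurable W
  measurable_ε : Measurable ε
  X_eq : ∀ ω, X ω = θ.A *ᵥ Z ω + W ω
  Y_eq : ∀ ω, Y ω = Z ω ⬝ᵥ θ.β + ε ω
  /-- `Z`, `W`, `ε` are mutually independent (together with the next field) -/
  indep_Z_W : IndepFun Z W P
  indep_ZW_ε : IndepFun (fun ω => (Z ω, W ω)) ε P
  memLp_Z : ∀ j, MemLp (fun ω => Z ω j) 2 P
  memLp_W : ∀ j, MemLp (fun ω => W ω j) 2 P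
  memLp_ε : MemLp ε 2 P
  mean_Z : ∀ j, ∫ ω, Z ω j ∂P = 0
  mean_W : ∀ j, ∫ ω, W ω j ∂P = 0
  mean_ε : ∫ ω, ε ω ∂P = 0
  cov_Z : ∀ j k, ∫ ω, Z ω j * Z ω k ∂P = θ.SigmaZ j k
  cov_W : ∀ j k, ∫ ω, W ω j * W ω k ∂P = θ.SigmaW j k
  var_ε : ∫ ω, ε ω ^ 2 ∂P = (θ.σ : ℝ) ^ 2
  rank_A : θ.A.rank = K
  rank_SigmaZ : θ.SigmaZ.rank = K

/-- The pair `(X, Y)` follows the sub-Gaussian factor regression model with parameter `θ` and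
sub-Gaussian constants `γz`, `γw`, `γε`. -/
structure IsSGFRM {Ω : Type*} [MeasurableSpace Ω] (P : Measure Ω) {p K : ℕ} (θ : Param p K)
    (γz γw γε : ℝ≥0) (Z : Ω → Fin K → ℝ) (W : Ω → Fin p → ℝ) (ε : Ω → ℝ)
    (X : Ω → Fin p → ℝ) (Y : Ω → ℝ) : Prop extends IsFRM P θ Z W ε X Y where
  subGaussian_ε : HasSubgaussianMGF ε ((θ.σ * γε) ^ 2) P
  subGaussian_Z : ∃ Zt : Ω → Fin K → ℝ, IsSubGaussianVector P Zt γz ∧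
    (∀ j k, ∫ ω, Zt ω j * Zt ω k ∂P = (1 : Matrix (Fin K) (Fin K) ℝ) j k) ∧
    ∀ᵐ ω ∂P, Z ω = matSqrt θ.SigmaZ *ᵥ Zt ω
  subGaussian_W : ∃ Wt : Ω → Fin p → ℝ, IsSubGaussianVector P Wt γw ∧
    (∀ j k, ∫ ω, Wt ω j * Wt ω k ∂P = (1 : Matrix (Fin p) (Fin p) ℝ) j k) ∧
    ∀ᵐ ω ∂P, W ω = matSqrt θ.SigmaW *ᵥ Wt ω

/-- `(X i, Y i)`, `i < n`, are `n` independent copies of a pair `(X, Y)` that follows the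
sub-Gaussian factor regression model; the latent variables of the copies are `(Z i, W i, ε i)`. -/
structure IsSGFRMSample {Ω : Type*} [MeasurableSpace Ω] (P : Measure Ω) {n p K : ℕ}
    (θ : Param p K) (γz γw γε : ℝ≥0) (Z : Fin n → Ω → Fin K → ℝ) (W : Fin n → Ω → Fin p → ℝ)
    (ε : Fin n → Ω → ℝ) (X : Fin n → Ω → Fin p → ℝ) (Y : Fin n → Ω → ℝ) : Prop where
  model : ∀ i, IsSGFRM P θ γz γw γε (Z i) (W i) (ε i) (X i) (Y i)
  indep : iIndepFun (fun i ω => (Z i ω, W i ω, ε i ω)) P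
  identDistrib : ∀ i j, IdentDistrib (fun ω => (Z i ω, W i ω, ε i ω))
    (fun ω => (Z j ω, W j ω, ε j ω)) P P

/-! ### Singular values and the penalized rank selector -/

/-- `σ_k(M)` for `k ≥ 1`: the `k`-th largest singular value (zero for `k > min(n, p)`).
Mathlib's sequence of singular values starts at index `0`. -/
noncomputable def singVal {n p : ℕ} (M : Matrix (Fin n) (Fin p) ℝ) (k : ℕ) : ℝ :=
  (Matrix.toEuclideanLin M).singularValues (k - 1)

/-- `λ̂_k = σ_k(M)² / n` for `k ≥ 1`, and `λ̂_0 = ∞`. -/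
noncomputable def lambdaHat {n p : ℕ} (M : Matrix (Fin n) (Fin p) ℝ) (k : ℕ) : EReal :=
  if k = 0 then ⊤ else ((singVal M k ^ 2 / n : ℝ) : EReal)

/-- An orthonormal basis of right singular vectors of `M`, in the order of non-increasing singular
values. -/
noncomputable def rightSingVec {n p : ℕ} (M : Matrix (Fin n) (Fin p) ℝ) :
    OrthonormalBasis (Fin p) ℝ (EuclideanSpace ℝ (Fin p)) :=
  (Matrix.toEuclideanLin M).isSymmetric_adjoint_comp_self.eigenvectorBasis
    finrank_euclideanSpace_fin

/-- The truncated singular value decomposition `M_(k) = ∑_{j ≤ k} σ_j u_j v_jᵀ`, the best rank `k`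
approximation of `M`. Here `σ_j u_j = M v_j` for the right singular vectors `v_j`. -/
noncomputable def truncSVD {n p : ℕ} (M : Matrix (Fin n) (Fin p) ℝ) (k : ℕ) :
    Matrix (Fin n) (Fin p) ℝ :=
  ∑ j : Fin p with j.val < k,
    Matrix.vecMulVec (M *ᵥ (rightSingVec M j).ofLp) (rightSingVec M j).ofLp

/-- The criterion `v̂_k² = ‖M - M_(k)‖_F² / (np - μ k)`. -/
noncomputable def vHatSq {n p : ℕ} (M : Matrix (Fin n) (Fin p) ℝ) (μ : ℝ) (k : ℕ) : ℝ :=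
  frobSq (M - truncSVD M k) / ((n : ℝ) * p - μ * k)

/-- `K̄ = ⌊κ/(1+κ) · np/μ⌋ ∧ n ∧ p`. -/
noncomputable def Kbar (n p : ℕ) (κ μ : ℝ) : ℕ :=
  min (min ⌊κ / (1 + κ) * ((n : ℝ) * p / μ)⌋₊ n) p

/-- `s` is a minimizer of `v̂_k²` over `0 ≤ k ≤ K̄`. -/
def IsRankSelector {n p : ℕ} (M : Matrix (Fin n) (Fin p) ℝ) (κ μ : ℝ) (s : ℕ) : Prop :=
  s ≤ Kbar n p κ μ ∧ ∀ k ≤ Kbar n p κ μ, vHatSq M μ s ≤ vHatSq M μ k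

theorem exists_isRankSelector {n p : ℕ} (M : Matrix (Fin n) (Fin p) ℝ) (κ μ : ℝ) :
    ∃ s, IsRankSelector M κ μ s := by
  obtain ⟨s, hs, h⟩ := Finset.exists_min_image (Finset.range (Kbar n p κ μ + 1))
    (vHatSq M μ) ⟨0, by simp⟩
  exact ⟨s, by simpa [Nat.lt_succ_iff] using hs,
    fun k hk => h k (by simpa [Nat.lt_succ_iff] using hk)⟩

end FactorRegression

/-! All the probability sits in two facts about the noise matrix W; the rest is deterministic.

Deterministic part. Write X = L + W with rank L ≤ K, let M bound ‖W‖_op², and let T_k be the energy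
of X beyond its first k singular values, so that the criterion is T_k/(np - μk). Weyl's inequality
gives σ_{K+1}(X)² ≤ M, hence T_K ≤ (n ∧ p)M, and restriction to a subspace of codimension at most 2K
gives T_K ≥ ‖W‖_F² - 2KM. If npM is small against μ‖W‖_F², a step beyond K removes at most M from
the numerator, too little to offset the smaller denominator, so s ≤ K. Optimality against s - 1
forces σ_s² ≥ μT_K/(np); optimality against s + 1 and K forces σ_{s+1}² ≤ μT_K/(np - μK), which is
of order M. This is `IsRankSelector.spec`.

Probabilistic part. M is of order n‖Σ_W‖ + tr Σ_W (`IsSubGaussianNoise.exists_opNorm_bound`), and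
‖W‖_F² exceeds n tr Σ_W/2 by Chebyshev (`IsSubGaussianNoise.measure_frobSq_le`). Both rest on the
exponential moment of ‖Wᵀu‖², obtained by Gaussian decoupling; an integral over a ball of vectors u
takes the place of a net. The effective rank condition gives (n ∧ p)‖Σ_W‖ ≤ tr Σ_W/c', which makes
npM small against μ‖W‖_F² for large c₀ and makes both spectral bounds multiples of δ_W. -/

namespace FactorRegression

/-! ### Singular values under a low-rank perturbation -/

section Spectral

open Module

variable {E F : Type*} [NormedAddCommGroup E] [InnerProductSpace ℝ E] [FiniteDimensional ℝ E]
  [NormedAddCommGroup F] [InnerProductSpace ℝ F] [FiniteDimensional ℝ F]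

/-- The eigenvector basis of `T* T`. -/
noncomputable def rightBasis (T : E →ₗ[ℝ] F) {p : ℕ} (hp : finrank ℝ E = p) :
    OrthonormalBasis (Fin p) ℝ E :=
  T.isSymmetric_adjoint_comp_self.eigenvectorBasis hp

lemma inner_map_rightBasis (T : E →ₗ[ℝ] F) {p : ℕ} (hp : finrank ℝ E = p) (x : E) (j : Fin p) :
    inner ℝ (T x) (T (rightBasis T hp j)) =
      T.singularValues j ^ 2 * inner ℝ (rightBasis T hp j) x := by
  have h := T.isSymmetric_adjoint_comp_self.apply_eigenvectorBasis hp j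
  have h1 : inner ℝ (T x) (T (rightBasis T hp j)) =
      inner ℝ x ((T.adjoint ∘ₗ T) (rightBasis T hp j)) := by
    rw [LinearMap.comp_apply, LinearMap.adjoint_inner_right]
  rw [h1, rightBasis, h, T.sq_singularValues_fin hp, real_inner_comm]
  simp [inner_smul_left]

lemma norm_sq_map_eq_sum (T : E →ₗ[ℝ] F) {p : ℕ} (hp : finrank ℝ E = p) (x : E) :
    ‖T x‖ ^ 2 = ∑ j : Fin p, T.singularValues j ^ 2 * inner ℝ (rightBasis T hp j) x ^ 2 := by
  have hx : T x = ∑ j, inner ℝ (rightBasis T hp j) x • T (rightBasis T hp j) := by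
    conv_lhs => rw [← (rightBasis T hp).sum_repr' x]
    simp
  rw [← real_inner_self_eq_norm_sq]
  nth_rewrite 2 [hx]
  rw [inner_sum]
  refine Finset.sum_congr rfl fun j _ => ?_
  rw [inner_smul_right, inner_map_rightBasis]
  ring

lemma norm_sq_map_rightBasis (T : E →ₗ[ℝ] F) {p : ℕ} (hp : finrank ℝ E = p) (j : Fin p) :
    ‖T (rightBasis T hp j)‖ ^ 2 = T.singularValues j ^ 2 := by
  rw [← real_inner_self_eq_norm_sq, inner_map_rightBasis, real_inner_self_eq_norm_sq,
    (rightBasis T hp).norm_eq_one]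
  simp

/-- The Hilbert–Schmidt norm does not depend on the orthonormal basis. -/
lemma sum_norm_sq_map_eq_adjoint {ι κ : Type*} [Fintype ι] [Fintype κ] (T : E →ₗ[ℝ] F)
    (b : OrthonormalBasis ι ℝ E) (f : OrthonormalBasis κ ℝ F) :
    ∑ i, ‖T (b i)‖ ^ 2 = ∑ k, ‖T.adjoint (f k)‖ ^ 2 := by
  simp_rw [← f.sum_sq_inner_right (T _), ← b.sum_sq_inner_right (T.adjoint _)]
  rw [Finset.sum_comm]
  refine Finset.sum_congr rfl fun k _ => Finset.sum_congr rfl fun i _ => ?_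
  rw [LinearMap.adjoint_inner_right, real_inner_comm]

lemma sum_norm_sq_map_eq {ι κ : Type*} [Fintype ι] [Fintype κ] (T : E →ₗ[ℝ] F)
    (b : OrthonormalBasis ι ℝ E) (c : OrthonormalBasis κ ℝ E) :
    ∑ i, ‖T (b i)‖ ^ 2 = ∑ k, ‖T (c k)‖ ^ 2 := by
  rw [sum_norm_sq_map_eq_adjoint T b (stdOrthonormalBasis ℝ F),
    sum_norm_sq_map_eq_adjoint T c (stdOrthonormalBasis ℝ F)]

/-- Weyl's inequality for a perturbation of a map of rank at most `K`. -/
lemma sq_singularValues_add_le (L N : E →ₗ[ℝ] F) {K : ℕ} (hL : finrank ℝ L.range ≤ K) {M : ℝ}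
    (hM : ∀ x, ‖N x‖ ^ 2 ≤ M * ‖x‖ ^ 2) (hM0 : 0 ≤ M) :
    (L + N).singularValues K ^ 2 ≤ M := by
  by_cases hK : finrank ℝ E ≤ K
  · simpa [(L + N).singularValues_of_finrank_le hK] using hM0
  push Not at hK
  set T := L + N with hT
  set v := rightBasis T rfl with hv
  let e : Fin (K + 1) → Fin (finrank ℝ E) := fun j => ⟨j, by omega⟩
  have he : Function.Injective e := fun i j h => by
    simpa [e, Fin.ext_iff] using h
  let S : (Fin (K + 1) → ℝ) →ₗ[ℝ] E := Fintype.linearCombination ℝ (fun j => v (e j))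
  have hli : LinearIndependent ℝ (fun j => v (e j)) :=
    (v.orthonormal.comp e he).linearIndependent
  have hS : ∀ c, S c = ∑ j, c j • v (e j) := fun c => Fintype.linearCombination_apply _ _ _
  -- L maps the span of the top K + 1 right singular vectors into dimension at most K, so it kills
  -- some nonzero x there; on x the sum equals N.
  have hker : LinearMap.ker (L.rangeRestrict ∘ₗ S) ≠ ⊥ := by
    apply LinearMap.ker_ne_bot_of_finrank_lt
    simpa using Nat.lt_succ_of_le hL
  obtain ⟨c, hc, hc0⟩ := Submodule.exists_mem_ne_zero_of_ne_bot hker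
  have hLc : L (S c) = 0 := by
    have := LinearMap.mem_ker.1 hc
    simpa using congrArg Subtype.val this
  set x := S c with hx
  have hx0 : x ≠ 0 := by
    intro h0
    apply hc0
    rw [Fintype.linearIndependent_iff] at hli
    ext j
    exact hli c (by rw [← hS]; exact h0) j
  have hTx : ‖T x‖ ^ 2 ≤ M * ‖x‖ ^ 2 := by
    have : T x = N x := by simp [hT, hLc]
    rw [this]; exact hM x
  have hort : ∀ j : Fin (finrank ℝ E), K < (j : ℕ) → inner ℝ (v j) x = 0 := by
    intro j hj
    rw [hx, hS, inner_sum]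
    refine Finset.sum_eq_zero fun i _ => ?_
    rw [inner_smul_right, v.orthonormal.2, mul_zero]
    intro h
    have : (j : ℕ) = i := by rw [h]
    have := i.2
    omega
  have hlow : T.singularValues K ^ 2 * ‖x‖ ^ 2 ≤ ‖T x‖ ^ 2 := by
    rw [norm_sq_map_eq_sum T rfl, ← v.sum_sq_inner_right x, Finset.mul_sum]
    refine Finset.sum_le_sum fun j _ => ?_
    rcases lt_or_ge K (j : ℕ) with hj | hj
    · rw [← hv, hort j hj]; simp
    · refine mul_le_mul_of_nonneg_right ?_ (sq_nonneg _)
      exact pow_le_pow_left₀ (T.singularValues_nonneg _) (T.singularValues_antitone hj) 2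
  have hpos : 0 < ‖x‖ ^ 2 := by positivity
  exact le_of_mul_le_mul_right (hlow.trans hTx) hpos

/-- The energy of `L + N` beyond its first `K` singular values, when `L` has rank at most `K`. -/
lemma sum_norm_sq_sub_le_tail (L N : E →ₗ[ℝ] F) {K : ℕ} (hL : finrank ℝ L.range ≤ K) {M : ℝ}
    (hM : ∀ x, ‖N x‖ ^ 2 ≤ M * ‖x‖ ^ 2) (hM0 : 0 ≤ M) {ι : Type*} [Fintype ι]
    (b : OrthonormalBasis ι ℝ E) {p : ℕ} (hp : finrank ℝ E = p) :
    ∑ i, ‖N (b i)‖ ^ 2 - 2 * K * M ≤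
      ∑ j : Fin p with K ≤ j.val, (L + N).singularValues j ^ 2 := by
  set T := L + N with hT
  set v := rightBasis T hp with hv
  -- The kernel V of `G` consists of vectors killed by L and orthogonal to the first K right
  -- singular vectors. Its complement has dimension at most 2K and carries at most 2KM of the energy
  -- of N.
  let G : E →ₗ[ℝ] (L.range × ({j : Fin p // j.val < K} → ℝ)) :=
    L.rangeRestrict.prod (LinearMap.pi fun j => (innerₛₗ ℝ (v j)))
  let V := LinearMap.ker G
  have hVL : ∀ x ∈ V, L x = 0 := fun x hx => by
    have h := congrArg (fun y => (y.1 : F)) (LinearMap.mem_ker.1 hx)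
    simpa [G] using h
  have hVv : ∀ x ∈ V, ∀ j : Fin p, j.val < K → inner ℝ (v j) x = 0 := fun x hx j hj => by
    have h := congrFun (congrArg (fun y => y.2) (LinearMap.mem_ker.1 hx)) ⟨j, hj⟩
    simpa [G] using h
  have hcard : Fintype.card {j : Fin p // j.val < K} ≤ K := by
    have : Function.Injective (fun j : {j : Fin p // j.val < K} => (⟨j.1.1, j.2⟩ : Fin K)) := by
      intro i j h
      simpa [Fin.ext_iff, Subtype.ext_iff] using h
    simpa using Fintype.card_le_of_injective _ this
  have hdim : finrank ℝ Vᗮ ≤ 2 * K := by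
    have h1 := V.finrank_add_finrank_orthogonal
    have h2 := G.finrank_range_add_finrank_ker
    have h3 : finrank ℝ G.range ≤ _ := Submodule.finrank_le G.range
    rw [Module.finrank_prod, Module.finrank_fintype_fun_eq_card] at h3
    have : finrank ℝ V = finrank ℝ (LinearMap.ker G) := rfl
    omega
  let b₁ := stdOrthonormalBasis ℝ V
  let b₂ := stdOrthonormalBasis ℝ Vᗮ
  let B := (b₁.prod b₂).map V.orthogonalDecomposition.symm
  have hB₁ : ∀ i, B (Sum.inl i) = b₁ i := fun i => by
    simp only [B, OrthonormalBasis.map_apply, LinearIsometryEquiv.symm_apply_eq,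
      Submodule.orthogonalDecomposition_apply]
    simp [Submodule.orthogonalProjectionOnto_orthogonal_apply_eq_zero (b₁ i).2]
  rw [sum_norm_sq_map_eq N b B, Fintype.sum_sum_type]
  have hsecond : ∑ i, ‖N (B (Sum.inr i))‖ ^ 2 ≤ 2 * K * M := by
    calc ∑ i, ‖N (B (Sum.inr i))‖ ^ 2 ≤ ∑ i : Fin (finrank ℝ Vᗮ), M := by
          refine Finset.sum_le_sum fun i _ => ?_
          have := hM (B (Sum.inr i))
          rwa [B.norm_eq_one, one_pow, mul_one] at this
      _ = finrank ℝ Vᗮ * M := by simp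
      _ ≤ 2 * K * M := by
          refine mul_le_mul_of_nonneg_right ?_ hM0
          exact_mod_cast hdim
  have hfirst : ∑ i, ‖N (B (Sum.inl i))‖ ^ 2 ≤
      ∑ j : Fin p with K ≤ j.val, T.singularValues j ^ 2 := by
    have hrow : ∀ i, ‖N (B (Sum.inl i))‖ ^ 2 = ∑ j : Fin p with K ≤ j.val,
        T.singularValues j ^ 2 * inner ℝ (v j) (B (Sum.inl i)) ^ 2 := by
      intro i
      have hmem : B (Sum.inl i) ∈ V := by rw [hB₁]; exact (b₁ i).2
      have : N (B (Sum.inl i)) = T (B (Sum.inl i)) := by simp [hT, hVL _ hmem]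
      rw [this, norm_sq_map_eq_sum T hp, Finset.sum_filter]
      refine Finset.sum_congr rfl fun j _ => ?_
      split_ifs with hj
      · rfl
      · rw [← hv, hVv _ hmem j (by omega)]; simp
    simp_rw [hrow]
    rw [Finset.sum_comm]
    refine Finset.sum_le_sum fun j _ => ?_
    rw [← Finset.mul_sum]
    -- Bessel: the V-part of the basis sees at most the unit norm of v j.
    refine mul_le_of_le_one_right (sq_nonneg _) ?_
    have h := B.sum_sq_inner_right (v j)
    rw [Fintype.sum_sum_type, v.norm_eq_one, one_pow] at h
    have h2 : 0 ≤ ∑ i, inner ℝ (B (Sum.inr i)) (v j) ^ 2 :=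
      Finset.sum_nonneg fun _ _ => sq_nonneg _
    simp_rw [real_inner_comm (v j)] at h h2 ⊢
    linarith
  linarith

end Spectral

/-! ### Tail energy and the truncated singular value decomposition -/

section Truncation

variable {n p : ℕ}

lemma frobSq_eq_sum_norm_sq {ι : Type*} [Fintype ι] (M : Matrix (Fin n) (Fin p) ℝ)
    (b : OrthonormalBasis ι ℝ (EuclideanSpace ℝ (Fin p))) :
    frobSq M = ∑ i, ‖Matrix.toEuclideanLin M (b i)‖ ^ 2 := by
  rw [sum_norm_sq_map_eq _ b (EuclideanSpace.basisFun (Fin p) ℝ), frobSq, Finset.sum_comm]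
  refine Finset.sum_congr rfl fun j _ => ?_
  rw [EuclideanSpace.norm_sq_eq]
  refine Finset.sum_congr rfl fun i _ => ?_
  simp

lemma toEuclideanLin_truncSVD (M : Matrix (Fin n) (Fin p) ℝ) (k : ℕ) (i : Fin p) :
    Matrix.toEuclideanLin (truncSVD M k) (rightSingVec M i) =
      if i.val < k then Matrix.toEuclideanLin M (rightSingVec M i) else 0 := by
  have hdot : ∀ j : Fin p, (rightSingVec M j).ofLp ⬝ᵥ (rightSingVec M i).ofLp =
      if j = i then 1 else 0 := fun j => by
    have h := (orthonormal_iff_ite.1 (rightSingVec M).orthonormal) i j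
    rw [PiLp.inner_apply] at h
    simp only [dotProduct, eq_comm (a := j)]
    simpa using h
  ext l
  rw [Matrix.ofLp_toLpLin, Matrix.toLin'_apply, truncSVD, Matrix.sum_mulVec]
  simp only [Matrix.vecMulVec_mulVec, hdot]
  split_ifs with hi
  · rw [Finset.sum_eq_single_of_mem i (by simpa using hi)
      (fun j _ hj => by simp [hj])]
    simp
  · rw [Finset.sum_eq_zero]
    · simp
    · intro j hj
      have : j ≠ i := by rintro rfl; exact hi (by simpa using hj)
      simp [this]

/-- The energy of the singular values of `M` with (zero-based) index at least `k`. -/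
noncomputable def tailEnergy (M : Matrix (Fin n) (Fin p) ℝ) (k : ℕ) : ℝ :=
  ∑ j : Fin p with k ≤ j.val, (Matrix.toEuclideanLin M).singularValues j ^ 2

/-- In the basis of right singular vectors the residual agrees with M from index k on and vanishes
before it. -/
lemma frobSq_sub_truncSVD (M : Matrix (Fin n) (Fin p) ℝ) (k : ℕ) :
    frobSq (M - truncSVD M k) = tailEnergy M k := by
  rw [frobSq_eq_sum_norm_sq _ (rightSingVec M), tailEnergy, Finset.sum_filter]
  refine Finset.sum_congr rfl fun j _ => ?_
  rw [map_sub, LinearMap.sub_apply, toEuclideanLin_truncSVD]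
  by_cases hj : k ≤ j.val
  · rw [if_neg (by omega), if_pos hj, sub_zero]
    exact norm_sq_map_rightBasis _ finrank_euclideanSpace_fin j
  · rw [if_pos (by omega), if_neg hj]; simp

lemma tailEnergy_eq_sum_Ico (M : Matrix (Fin n) (Fin p) ℝ) (k : ℕ) :
    tailEnergy M k = ∑ j ∈ Finset.Ico k p, (Matrix.toEuclideanLin M).singularValues j ^ 2 := by
  rw [tailEnergy, Finset.sum_filter, Fin.sum_univ_eq_sum_range
    (fun j => if k ≤ j then (Matrix.toEuclideanLin M).singularValues j ^ 2 else 0),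
    ← Finset.sum_filter]
  refine Finset.sum_congr ?_ fun _ _ => rfl
  ext j; simp [and_comm]

lemma tailEnergy_eq_add (M : Matrix (Fin n) (Fin p) ℝ) (k : ℕ) :
    tailEnergy M k = (Matrix.toEuclideanLin M).singularValues k ^ 2 + tailEnergy M (k + 1) := by
  rw [tailEnergy_eq_sum_Ico, tailEnergy_eq_sum_Ico]
  rcases lt_or_ge k p with hk | hk
  · exact Finset.sum_eq_sum_Ico_succ_bot hk _
  · rw [LinearMap.singularValues_of_finrank_le _ (by simpa using hk),
      Finset.Ico_eq_empty (by omega), Finset.Ico_eq_empty (by omega)]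
    simp

lemma tailEnergy_antitone (M : Matrix (Fin n) (Fin p) ℝ) : Antitone (tailEnergy M) :=
  antitone_nat_of_succ_le fun k => by
    rw [tailEnergy_eq_add M k]; exact le_add_of_nonneg_left (sq_nonneg _)

lemma sq_singularValues_antitone (M : Matrix (Fin n) (Fin p) ℝ) :
    Antitone fun k => (Matrix.toEuclideanLin M).singularValues k ^ 2 := fun _ _ h =>
  pow_le_pow_left₀ (LinearMap.singularValues_nonneg _ _) (LinearMap.singularValues_antitone _ h) 2

lemma tailEnergy_sub_le (M : Matrix (Fin n) (Fin p) ℝ) (k d : ℕ) :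
    tailEnergy M k - tailEnergy M (k + d) ≤
      d * (Matrix.toEuclideanLin M).singularValues k ^ 2 := by
  induction d with
  | zero => simp
  | succ d ih =>
    have h := tailEnergy_eq_add M (k + d)
    have h2 := sq_singularValues_antitone M (Nat.le_add_right k d)
    simp only at h2
    rw [← add_assoc]
    push_cast
    linarith

lemma tailEnergy_le_min_mul (M : Matrix (Fin n) (Fin p) ℝ) (k : ℕ) :
    tailEnergy M k ≤ min (n : ℝ) p * (Matrix.toEuclideanLin M).singularValues k ^ 2 := by
  have hzero : tailEnergy M (k + min n p) = 0 := by
    rw [tailEnergy_eq_sum_Ico]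
    refine Finset.sum_eq_zero fun j hj => ?_
    rw [Finset.mem_Ico] at hj
    rw [(LinearMap.singularValues_eq_zero_iff_le_finrank_range _).2]
    · simp
    · have := Submodule.finrank_le (Matrix.toEuclideanLin M).range
      rw [finrank_euclideanSpace_fin] at this
      omega
  have h := tailEnergy_sub_le M k (min n p)
  rw [hzero, sub_zero] at h
  exact_mod_cast h

end Truncation

/-! ### Deterministic analysis of the minimizer -/

section Selector

variable {n p K : ℕ}

/-- Keeps np - μk at least np/(1+κ) for admissible k, so the denominators of the criterion are
positive and comparable to np. -/
lemma Kbar_mul_le {κ μ : ℝ} (hκ : 0 < κ) (hμ : 0 < μ) {k : ℕ} (hk : k ≤ Kbar n p κ μ) :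
    (1 + κ) * (μ * k) ≤ κ * (n * p) := by
  have h1 : k ≤ ⌊κ / (1 + κ) * ((n : ℝ) * p / μ)⌋₊ :=
    hk.trans ((min_le_left _ _).trans (min_le_left _ _))
  have h2 : (k : ℝ) ≤ κ / (1 + κ) * ((n : ℝ) * p / μ) :=
    (Nat.le_floor_iff (by positivity)).1 h1
  have h3 : κ / (1 + κ) * ((n : ℝ) * p / μ) = κ * (n * p) / ((1 + κ) * μ) := by
    field_simp
  rw [h3, le_div_iff₀ (by positivity)] at h2
  linarith

/-- Deterministic analysis of the rank selector: if the squared operator norm `M` of the noise is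
small compared with `μ ‖W‖_F² / (np)`, the selected rank is at most the rank of the signal, and the
singular values around it are controlled. -/
theorem IsRankSelector.spec {X L W : Matrix (Fin n) (Fin p) ℝ} (hX : X = L + W)
    (hL : L.rank ≤ K) {M : ℝ} (hM0 : 0 ≤ M)
    (hM : ∀ x, ‖Matrix.toEuclideanLin W x‖ ^ 2 ≤ M * ‖x‖ ^ 2) {κ c₀ : ℝ} (hκ : 0 < κ)
    (hc₀ : 0 < c₀) (hn : 1 ≤ n) (hp : 1 ≤ p) (hK : K ≤ Kbar n p κ (c₀ * (n + p)))
    (hgap : 4 * (n * p) * M < c₀ * (n + p) * frobSq W) {s : ℕ}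
    (hs : IsRankSelector X κ (c₀ * (n + p)) s) :
    s ≤ K ∧ (s ≠ 0 → c₀ * (n + p) * frobSq W ≤ 2 * (n * p) * singVal X s ^ 2) ∧
      singVal X (s + 1) ^ 2 ≤ (1 + 2 * (1 + κ) * c₀) * M := by
  have hn' : (0 : ℝ) < n := by exact_mod_cast hn
  have hp' : (0 : ℝ) < p := by exact_mod_cast hp
  set μ : ℝ := c₀ * (n + p) with hμdef
  have hμ : 0 < μ := by positivity
  obtain ⟨hsK, hmin⟩ := hs
  set σ : ℕ → ℝ := fun k => (Matrix.toEuclideanLin X).singularValues k ^ 2 with hσ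
  have hrank : Module.finrank ℝ (Matrix.toEuclideanLin L).range ≤ K := by
    rw [Matrix.rank_eq_finrank_range_toLin L (EuclideanSpace.basisFun _ ℝ).toBasis
      (EuclideanSpace.basisFun _ ℝ).toBasis] at hL
    rwa [Matrix.toEuclideanLin_eq_toLin_orthonormal]
  have hXlin : Matrix.toEuclideanLin X = Matrix.toEuclideanLin L + Matrix.toEuclideanLin W := by
    rw [hX, map_add]
  have hσK : σ K ≤ M := by
    simp only [hσ, hXlin]
    exact sq_singularValues_add_le _ _ hrank hM hM0
  have htail : frobSq W - 2 * K * M ≤ tailEnergy X K := by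
    rw [frobSq_eq_sum_norm_sq W (EuclideanSpace.basisFun _ ℝ), tailEnergy, hXlin]
    exact sum_norm_sq_sub_le_tail _ _ hrank hM hM0 _ finrank_euclideanSpace_fin
  have htailU : tailEnergy X K ≤ min (n : ℝ) p * M :=
    (tailEnergy_le_min_mul X K).trans (mul_le_mul_of_nonneg_left hσK (by positivity))
  have hden : ∀ k ≤ Kbar n p κ μ, n * p ≤ (1 + κ) * ((n : ℝ) * p - μ * k) := fun k hk => by
    have := Kbar_mul_le (n := n) (p := p) hκ hμ hk
    linarith
  have hnp : (0 : ℝ) < n * p := by positivity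
  have hdpos : ∀ k ≤ Kbar n p κ μ, 0 < (n : ℝ) * p - μ * k := fun k hk => by
    have := hnp.trans_le (hden k hk)
    exact (pos_iff_pos_of_mul_pos this).1 (by positivity)
  have hcmp : ∀ k ≤ Kbar n p κ μ, tailEnergy X s * ((n : ℝ) * p - μ * k) ≤
      tailEnergy X k * ((n : ℝ) * p - μ * s) := fun k hk => by
    have h := hmin k hk
    simp only [vHatSq, frobSq_sub_truncSVD] at h
    rwa [div_le_div_iff₀ (hdpos s hsK) (hdpos k hk)] at h
  have hμK : μ * K ≤ n * p := by have := hdpos K hK; linarith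
  -- As μK ≤ np, the loss 2KM in the tail costs at most 2npM, half of what `hgap` allows.
  have hKM : μ * (2 * K * M) ≤ 2 * (n * p) * M := by
    have := mul_le_mul_of_nonneg_right hμK hM0
    linarith
  have htailμ : μ * frobSq W - 2 * (n * p) * M ≤ μ * tailEnergy X K := by
    have := mul_le_mul_of_nonneg_left htail hμ.le
    rw [mul_sub] at this
    linarith
  -- For s = K + d + 1, optimality against K gives (d+1)μT_K ≤ (T_K - T_s)(np - μK) ≤ (d+1)M(np -
  -- μK), against μT_K > 2npM.
  have hsle : s ≤ K := by
    by_contra! hlt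
    obtain ⟨d, rfl⟩ := Nat.exists_eq_add_of_lt hlt
    have hd : (0 : ℝ) < (d + 1 : ℕ) := by positivity
    have h1 := hcmp K hK
    have h2 := tailEnergy_sub_le X K (d + 1)
    have h3 : tailEnergy X K - tailEnergy X (K + (d + 1)) ≤ (d + 1 : ℕ) * M :=
      h2.trans (mul_le_mul_of_nonneg_left hσK hd.le)
    rw [add_assoc] at h1
    have h4 := mul_le_mul_of_nonneg_right h3 (hdpos K hK).le
    have h5 : (d + 1 : ℕ) * (μ * tailEnergy X K) ≤
        (d + 1 : ℕ) * (M * ((n : ℝ) * p - μ * K)) := by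
      push_cast at h1 h4 ⊢
      linarith
    have h6 := le_of_mul_le_mul_left h5 hd
    have h7 : 0 ≤ M * (μ * K) := by positivity
    have h8 : 0 ≤ (n * p) * M := by positivity
    linarith
  refine ⟨hsle, fun hs0 => ?_, ?_⟩
  -- Optimality against r = s - 1 gives μT_s ≤ np σ_s², and T_s ≥ T_K. The zero-based index of σ_s
  -- is r.
  · obtain ⟨r, rfl⟩ := Nat.exists_eq_succ_of_ne_zero hs0
    have h1 := hcmp r (by omega)
    rw [tailEnergy_eq_add X r] at h1
    have h2 := tailEnergy_antitone X hsle
    have h3 : singVal X r.succ ^ 2 = (Matrix.toEuclideanLin X).singularValues r ^ 2 := by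
      simp [singVal]
    rw [h3]
    have h4 := mul_le_mul_of_nonneg_left h2 hμ.le
    have h5 : 0 ≤ (Matrix.toEuclideanLin X).singularValues r ^ 2 * (μ * (r + 1)) := by positivity
    simp only [Nat.succ_eq_add_one] at *
    push_cast at h1
    linarith
  · have h3 : singVal X (s + 1) ^ 2 = σ s := by simp [singVal, hσ]
    rw [h3]
    have h8 : 0 ≤ 2 * (1 + κ) * c₀ * M := by positivity
    -- For s = K Weyl's bound suffices and yields the summand 1 of the constant; for s < K the
    -- comparisons with s + 1 and K combine.
    rcases hsle.eq_or_lt with rfl | hlt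
    · linarith
    · have h1 := hcmp (s + 1) (by omega)
      have h2 := hcmp K hK
      have h4 : tailEnergy X s = σ s + tailEnergy X (s + 1) := tailEnergy_eq_add X s
      have h5 : σ s * ((n : ℝ) * p - μ * s) ≤ μ * tailEnergy X s := by
        push_cast at h1
        have : tailEnergy X (s + 1) = tailEnergy X s - σ s := by linarith
        rw [this] at h1
        linarith
      have h6 : σ s * ((n : ℝ) * p - μ * K) ≤ μ * tailEnergy X K := by
        refine le_of_mul_le_mul_right ?_ (hdpos s hsK)
        have e1 := mul_le_mul_of_nonneg_right h5 (hdpos K hK).le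
        have e2 := mul_le_mul_of_nonneg_left h2 hμ.le
        linarith
      have hσ0 : 0 ≤ σ s := sq_nonneg _
      have h7 : σ s * (n * p) ≤ (1 + κ) * (μ * (min (n : ℝ) p * M)) := by
        have e1 := mul_le_mul_of_nonneg_left (hden K hK) hσ0
        have e2 := mul_le_mul_of_nonneg_left (h6.trans
          (mul_le_mul_of_nonneg_left htailU hμ.le)) (by positivity : 0 ≤ 1 + κ)
        linarith
      have h9 : ((n : ℝ) + p) * min (n : ℝ) p ≤ 2 * (n * p) := by
        have e1 := mul_le_mul_of_nonneg_left (min_le_right (n : ℝ) p) hn'.le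
        have e2 := mul_le_mul_of_nonneg_left (min_le_left (n : ℝ) p) hp'.le
        linarith
      have h10 : σ s * (n * p) ≤ (2 * (1 + κ) * c₀ * M) * (n * p) := by
        have e := mul_le_mul_of_nonneg_left h9 (by positivity : 0 ≤ (1 + κ) * c₀ * M)
        rw [hμdef] at h7
        linarith
      have := le_of_mul_le_mul_right h10 hnp
      linarith

end Selector

/-! ### Exponential moments of squares by Gaussian decoupling -/

section GaussianDecoupling

lemma lintegral_exp_mul_gaussianReal (s : ℝ) :
    ∫⁻ x, ENNReal.ofReal (Real.exp (s * x)) ∂gaussianReal 0 1 =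
      ENNReal.ofReal (Real.exp (s ^ 2 / 2)) := by
  rw [← ofReal_integral_eq_lintegral_ofReal (integrable_exp_mul_gaussianReal s)
    (ae_of_all _ fun x => (Real.exp_pos _).le)]
  congr 1
  have h := congrFun (mgf_id_gaussianReal (μ := 0) (v := 1)) s
  simpa [mgf] using h

/-- The integral equals (1 - 2a)^(-1/2), and (1 - 2a)(1 + 4a) ≥ 1 exactly because 0 ≤ a ≤ 1/4. -/
lemma lintegral_exp_mul_sq_gaussianReal_le {a : ℝ} (ha0 : 0 ≤ a) (ha : a ≤ 1 / 4) :
    ∫⁻ x, ENNReal.ofReal (Real.exp (a * x ^ 2)) ∂gaussianReal 0 1 ≤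
      ENNReal.ofReal (Real.exp (2 * a)) := by
  have hb : 0 < 1 / 2 - a := by linarith
  rw [gaussianReal_of_var_ne_zero _ one_ne_zero,
    lintegral_withDensity_eq_lintegral_mul _ (measurable_gaussianPDF _ _) (by fun_prop)]
  have hpt : ∀ x : ℝ, (gaussianPDF 0 1 * fun x => ENNReal.ofReal (Real.exp (a * x ^ 2))) x =
      ENNReal.ofReal ((√(2 * Real.pi))⁻¹ * Real.exp (-(1 / 2 - a) * x ^ 2)) := fun x => by
    rw [Pi.mul_apply, gaussianPDF, ← ENNReal.ofReal_mul (gaussianPDFReal_nonneg _ _ _),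
      gaussianPDFReal, mul_assoc, ← Real.exp_add]
    simp only [NNReal.coe_one, mul_one, sub_zero]
    ring_nf
  simp_rw [hpt]
  rw [← ofReal_integral_eq_lintegral_ofReal ((integrable_exp_neg_mul_sq hb).const_mul _)
    (ae_of_all _ fun x => by positivity), integral_const_mul, integral_gaussian]
  refine ENNReal.ofReal_le_ofReal ?_
  rw [← Real.sqrt_inv, ← Real.sqrt_mul (by positivity)]
  refine Real.sqrt_le_iff.2 ⟨(Real.exp_pos _).le, ?_⟩
  have h1 : (2 * Real.pi)⁻¹ * (Real.pi / (1 / 2 - a)) = (1 - 2 * a)⁻¹ := by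
    have hne : 1 - 2 * a ≠ 0 := by linarith
    have : (1 / 2 - a) = (1 - 2 * a) / 2 := by ring
    rw [this]
    field_simp
  rw [h1, ← Real.exp_nat_mul]
  calc (1 - 2 * a)⁻¹ ≤ 1 + 4 * a := by
        rw [inv_le_iff_one_le_mul₀ (by linarith)]
        nlinarith
    _ ≤ Real.exp (4 * a) := by linarith [Real.add_one_le_exp (4 * a)]
    _ = _ := by congr 1; push_cast; ring

lemma lintegral_pi_prod {ι : Type*} [Fintype ι] (ν : Measure ℝ) [IsProbabilityMeasure ν]
    {f : ι → ℝ → ENNReal} (hf : ∀ i, Measurable (f i)) :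
    ∫⁻ g : ι → ℝ, ∏ i, f i (g i) ∂Measure.pi (fun _ => ν) = ∏ i, ∫⁻ x, f i x ∂ν := by
  rw [lintegral_prod_eq_prod_lintegral_of_indepFun Finset.univ (fun i (g : ι → ℝ) => f i (g i))
    (iIndepFun_pi fun i => (hf i).aemeasurable)
    (fun i => (hf i).comp (measurable_pi_apply i))]
  refine Finset.prod_congr rfl fun i _ => ?_
  exact (measurePreserving_eval (fun _ : ι => ν) i).lintegral_comp (hf i)

lemma ofReal_exp_sum {ι : Type*} (s : Finset ι) (f : ι → ℝ) :
    ENNReal.ofReal (Real.exp (∑ i ∈ s, f i)) = ∏ i ∈ s, ENNReal.ofReal (Real.exp (f i)) := by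
  rw [Real.exp_sum, ENNReal.ofReal_prod_of_nonneg fun _ _ => (Real.exp_pos _).le]

variable {Ω : Type*} [MeasurableSpace Ω] {P : Measure Ω}

/-- Exponential moment of a weighted sum of squares of sub-Gaussian coordinates, by decoupling
with an independent standard Gaussian vector. -/
lemma lintegral_exp_sum_sq_le [IsProbabilityMeasure P] {q : ℕ} {Y : Fin q → Ω → ℝ}
    (hY : ∀ j, Measurable (Y j)) {τ : Fin q → ℝ} (hτ : ∀ j, 0 ≤ τ j)
    (hsub : ∀ a : Fin q → ℝ, ∫⁻ ω, ENNReal.ofReal (Real.exp (∑ j, a j * Y j ω)) ∂P ≤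
      ENNReal.ofReal (Real.exp ((∑ j, τ j * a j ^ 2) / 2)))
    {l : ℝ} (hl : 0 ≤ l) (hlτ : ∀ j, l * τ j ≤ 1 / 4) :
    ∫⁻ ω, ENNReal.ofReal (Real.exp (l * ∑ j, Y j ω ^ 2)) ∂P ≤
      ENNReal.ofReal (Real.exp (2 * l * ∑ j, τ j)) := by
  -- Chosen so that exp(l y²) = E exp(r g y) for a standard Gaussian g. The exponent becomes linear
  -- in Y, and Tonelli lets the hypothesis act first.
  set r := √(2 * l) with hr
  have hr2 : r ^ 2 = 2 * l := Real.sq_sqrt (by positivity)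
  let ν : Measure (Fin q → ℝ) := Measure.pi fun _ => gaussianReal 0 1
  have hlin : ∀ ω, ENNReal.ofReal (Real.exp (l * ∑ j, Y j ω ^ 2)) =
      ∫⁻ g, ENNReal.ofReal (Real.exp (∑ j, (r * g j) * Y j ω)) ∂ν := fun ω => by
    simp_rw [ofReal_exp_sum]
    rw [lintegral_pi_prod (gaussianReal 0 1)
      (f := fun j x => ENNReal.ofReal (Real.exp (r * x * Y j ω))) (fun j => by fun_prop),
      Finset.mul_sum, ofReal_exp_sum]
    refine Finset.prod_congr rfl fun j _ => ?_
    have := lintegral_exp_mul_gaussianReal (r * Y j ω)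
    rw [mul_pow, hr2] at this
    rw [show l * Y j ω ^ 2 = 2 * l * Y j ω ^ 2 / 2 by ring, ← this]
    refine lintegral_congr fun x => ?_
    ring_nf
  simp_rw [hlin]
  rw [lintegral_lintegral_swap]
  · calc ∫⁻ g, ∫⁻ ω, ENNReal.ofReal (Real.exp (∑ j, (r * g j) * Y j ω)) ∂P ∂ν
        ≤ ∫⁻ g, ∏ j, ENNReal.ofReal (Real.exp (l * τ j * g j ^ 2)) ∂ν := by
          refine lintegral_mono fun g => (hsub fun j => r * g j).trans (le_of_eq ?_)
          rw [← ofReal_exp_sum, Finset.sum_div]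
          congr 3
          ext j
          rw [mul_pow, hr2]; ring
      _ = ∏ j, ∫⁻ x, ENNReal.ofReal (Real.exp (l * τ j * x ^ 2)) ∂gaussianReal 0 1 :=
          lintegral_pi_prod (gaussianReal 0 1)
            (f := fun j x => ENNReal.ofReal (Real.exp (l * τ j * x ^ 2))) (fun j => by fun_prop)
      _ ≤ ∏ j, ENNReal.ofReal (Real.exp (2 * (l * τ j))) :=
          Finset.prod_le_prod' fun j _ =>
            lintegral_exp_mul_sq_gaussianReal_le (mul_nonneg hl (hτ j)) (hlτ j)
      _ = _ := by
          rw [← ofReal_exp_sum, Finset.mul_sum]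
          congr 3
          ext j
          ring
  · refine Measurable.aemeasurable ?_
    have : ∀ j, Measurable fun z : Ω × (Fin q → ℝ) => Y j z.1 := fun j =>
      (hY j).comp measurable_fst
    fun_prop

end GaussianDecoupling

/-! ### Sub-Gaussian noise rows -/

section Noise

variable {Ω : Type*} [MeasurableSpace Ω] {P : Measure Ω} {n p : ℕ}

lemma norm_toEuclideanLin_le (S : Matrix (Fin n) (Fin p) ℝ) (x : EuclideanSpace ℝ (Fin p)) :
    ‖Matrix.toEuclideanLin S x‖ ≤ opNorm S * ‖x‖ :=
  (Matrix.toEuclideanLin S).toContinuousLinearMap.le_opNorm x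

lemma eigenvalues_le_opNorm {S : Matrix (Fin p) (Fin p) ℝ} (hS : S.IsHermitian) (j : Fin p) :
    hS.eigenvalues j ≤ opNorm S := by
  have h := norm_toEuclideanLin_le S (hS.eigenvectorBasis j)
  have h2 : Matrix.toEuclideanLin S (hS.eigenvectorBasis j) =
      hS.eigenvalues j • hS.eigenvectorBasis j := by
    ext i
    have := congrFun (hS.mulVec_eigenvectorBasis j) i
    simpa [Matrix.toLpLin_apply] using this
  rw [h2, norm_smul, hS.eigenvectorBasis.norm_eq_one, mul_one, mul_one] at h
  exact (le_abs_self _).trans h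

lemma eigenvalues_le_trace {S : Matrix (Fin p) (Fin p) ℝ} (hS : S.PosSemidef) (j : Fin p) :
    hS.isHermitian.eigenvalues j ≤ S.trace := by
  rw [hS.isHermitian.trace_eq_sum_eigenvalues]
  exact Finset.single_le_sum (fun i _ => hS.eigenvalues_nonneg i) (Finset.mem_univ j)

/-- The rows `W i` are independent and sub-Gaussian relative to the covariance matrix `S`. -/
structure IsSubGaussianNoise (P : Measure Ω) (W : Fin n → Ω → Fin p → ℝ)
    (S : Matrix (Fin p) (Fin p) ℝ) (γ : ℝ) : Prop where
  measurable : ∀ i, Measurable (W i)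
  indep : iIndepFun W P
  posSemidef : S.PosSemidef
  lintegral_exp_le : ∀ i (v : Fin p → ℝ),
    ∫⁻ ω, ENNReal.ofReal (Real.exp (v ⬝ᵥ W i ω)) ∂P ≤
      ENNReal.ofReal (Real.exp (γ ^ 2 * (v ⬝ᵥ S *ᵥ v) / 2))

variable {W : Fin n → Ω → Fin p → ℝ} {S : Matrix (Fin p) (Fin p) ℝ} {γ : ℝ}

lemma IsSubGaussianNoise.lintegral_exp_sum_le (h : IsSubGaussianNoise P W S γ)
    (u : Fin n → ℝ) (v : Fin p → ℝ) :
    ∫⁻ ω, ENNReal.ofReal (Real.exp (∑ i, u i * (v ⬝ᵥ W i ω))) ∂P ≤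
      ENNReal.ofReal (Real.exp (γ ^ 2 * (∑ i, u i ^ 2) * (v ⬝ᵥ S *ᵥ v) / 2)) := by
  have hm : ∀ i, Measurable fun w : Fin p → ℝ =>
      ENNReal.ofReal (Real.exp (u i * (v ⬝ᵥ w))) := fun i => by
    simp only [dotProduct]; fun_prop
  simp_rw [ofReal_exp_sum]
  rw [lintegral_prod_eq_prod_lintegral_of_indepFun Finset.univ
    (fun i ω => ENNReal.ofReal (Real.exp (u i * (v ⬝ᵥ W i ω))))
    (h.indep.comp (fun i w => ENNReal.ofReal (Real.exp (u i * (v ⬝ᵥ w)))) hm)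
    (fun i => (hm i).comp (h.measurable i))]
  calc _ ≤ ∏ i, ENNReal.ofReal (Real.exp (γ ^ 2 * u i ^ 2 * (v ⬝ᵥ S *ᵥ v) / 2)) := by
        refine Finset.prod_le_prod' fun i _ => ?_
        have := h.lintegral_exp_le i (u i • v)
        simp only [smul_dotProduct, smul_eq_mul, Matrix.mulVec_smul, dotProduct_smul] at this
        refine this.trans (le_of_eq ?_)
        congr 2; ring
    _ = _ := by
        rw [← ofReal_exp_sum, ← Finset.sum_div, ← Finset.sum_mul, ← Finset.mul_sum]

/-- Exponential moment of the squared norm of `∑ i, u i • W i`. -/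
lemma IsSubGaussianNoise.lintegral_exp_sq_le [IsProbabilityMeasure P]
    (h : IsSubGaussianNoise P W S γ) (u : Fin n → ℝ) {l t : ℝ} (hl : 0 ≤ l)
    (ht : ∀ j, h.posSemidef.isHermitian.eigenvalues j ≤ t)
    (hle : l * (γ ^ 2 * (∑ i, u i ^ 2) * t) ≤ 1 / 4) :
    ∫⁻ ω, ENNReal.ofReal (Real.exp (l * ∑ j, (∑ i, u i * W i ω j) ^ 2)) ∂P ≤
      ENNReal.ofReal (Real.exp (2 * l * (γ ^ 2 * (∑ i, u i ^ 2) * S.trace))) := by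
  have hH := h.posSemidef.isHermitian
  set v := hH.eigenvectorBasis with hv
  set e := hH.eigenvalues with he
  have he0 : ∀ j, 0 ≤ e j := fun j => h.posSemidef.eigenvalues_nonneg j
  have hU : 0 ≤ γ ^ 2 * ∑ i, u i ^ 2 := by positivity
  -- In the eigenbasis of `S` the coordinates of ξ = ∑ uᵢWᵢ have a diagonal variance proxy with
  -- entries γ²‖u‖² times the eigenvalues, which sum to γ²‖u‖² tr S.
  let ξ : Ω → EuclideanSpace ℝ (Fin p) := fun ω => WithLp.toLp 2 fun j => ∑ i, u i * W i ω j
  have hinner : ∀ (x : EuclideanSpace ℝ (Fin p)) ω,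
      inner ℝ x (ξ ω) = ∑ i, u i * (x.ofLp ⬝ᵥ W i ω) := fun x ω => by
    simp only [PiLp.inner_apply, ξ, dotProduct, Finset.mul_sum, RCLike.inner_apply, conj_trivial,
      Finset.sum_mul]
    rw [Finset.sum_comm]
    refine Finset.sum_congr rfl fun i _ => Finset.sum_congr rfl fun j _ => ?_
    ring
  have hsq : ∀ ω, ∑ j, (∑ i, u i * W i ω j) ^ 2 = ∑ j, inner ℝ (v j) (ξ ω) ^ 2 := fun ω => by
    rw [v.sum_sq_inner_right, EuclideanSpace.real_norm_sq_eq]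
  simp_rw [hsq]
  have htr : γ ^ 2 * (∑ i, u i ^ 2) * S.trace = ∑ j, γ ^ 2 * (∑ i, u i ^ 2) * e j := by
    rw [hH.trace_eq_sum_eigenvalues, Finset.mul_sum]; rfl
  rw [htr]
  have hmW : ∀ i j, Measurable fun ω => W i ω j := fun i j =>
    (measurable_pi_apply j).comp (h.measurable i)
  refine lintegral_exp_sum_sq_le (Y := fun j ω => inner ℝ (v j) (ξ ω)) (fun j => ?_)
    (fun j => mul_nonneg hU (he0 j)) (fun a => ?_) hl (fun j => ?_)
  · simp only [hinner, dotProduct]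
    fun_prop
  · have hx : ∀ ω, ∑ j, a j * inner ℝ (v j) (ξ ω) = inner ℝ (∑ j, a j • v j) (ξ ω) := fun ω => by
      simp [sum_inner, inner_smul_left]
    simp_rw [hx, hinner]
    refine (h.lintegral_exp_sum_le u _).trans (le_of_eq ?_)
    congr 3
    have hSv : S *ᵥ (∑ j, a j • v j).ofLp = (∑ j, (a j * e j) • v j).ofLp := by
      simp only [WithLp.ofLp_sum, WithLp.ofLp_smul, Matrix.mulVec_sum, Matrix.mulVec_smul]
      refine Finset.sum_congr rfl fun j _ => ?_
      rw [hv, hH.mulVec_eigenvectorBasis, smul_smul]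
    have hdot : (∑ j, a j • v j).ofLp ⬝ᵥ (∑ j, (a j * e j) • v j).ofLp =
        inner ℝ (∑ j, (a j * e j) • v j) (∑ j, a j • v j) := by
      simp [PiLp.inner_apply, dotProduct]
    rw [hSv, hdot, v.orthonormal.inner_sum, Finset.mul_sum]
    refine Finset.sum_congr rfl fun j _ => ?_
    simp
    ring
  · refine le_trans (mul_le_mul_of_nonneg_left ?_ hl) hle
    exact mul_le_mul_of_nonneg_left (ht j) hU

end Noise

/-! ### Operator norm from an integral over a ball -/

section OperatorNorm

/-- The integral of `exp (l ‖T u‖²)` over a ball controls the operator norm of `T`. -/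
lemma exists_norm_bound_of_lintegral_exp {E F : Type*} [NormedAddCommGroup E]
    [InnerProductSpace ℝ E] [FiniteDimensional ℝ E] [MeasurableSpace E] [BorelSpace E]
    [NormedAddCommGroup F] [InnerProductSpace ℝ F] (T : E →ₗ[ℝ] F) {l : ℝ} (hl : 0 ≤ l) :
    ∃ M : ℝ, 0 ≤ M ∧ (∀ x, ‖T x‖ ≤ M * ‖x‖) ∧
      ENNReal.ofReal (Real.exp (l * (M ^ 2 / 4))) * volume (Metric.ball (0 : E) (1 / 2)) ≤
        ∫⁻ u in Metric.ball (0 : E) (3 / 2), ENNReal.ofReal (Real.exp (l * ‖T u‖ ^ 2)) := by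
  have hcont : Continuous T := T.continuous_of_finiteDimensional
  -- At a maximizer u on the unit ball, every w within 1/2 of u has ‖T w‖ ≥ ‖T u‖/2, and all such w
  -- lie in the ball of radius 3/2.
  obtain ⟨u, hu, hmax⟩ := (isCompact_closedBall (0 : E) 1).exists_isMaxOn
    ⟨0, by simp⟩ (f := fun x => ‖T x‖) (by fun_prop)
  rw [mem_closedBall_zero_iff] at hu
  have hM : ∀ x, ‖T x‖ ≤ ‖T u‖ * ‖x‖ := fun x => by
    rcases eq_or_ne x 0 with rfl | hx
    · simp
    have hx0 : 0 < ‖x‖ := norm_pos_iff.2 hx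
    have h := hmax (a := ‖x‖⁻¹ • x) (by
      rw [mem_closedBall_zero_iff, norm_smul, norm_inv, norm_norm, inv_mul_cancel₀ hx0.ne'])
    simp only [Set.mem_ofPred_eq, map_smul, norm_smul, norm_inv, norm_norm] at h
    rwa [inv_mul_le_iff₀ hx0, mul_comm] at h
  refine ⟨‖T u‖, norm_nonneg _, hM, ?_⟩
  rw [← Measure.addHaar_ball_center volume u]
  have hsub : Metric.ball u (1 / 2) ⊆ Metric.ball (0 : E) (3 / 2) := fun w hw => by
    rw [Metric.mem_ball, dist_eq_norm] at hw
    rw [mem_ball_zero_iff]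
    calc ‖w‖ = ‖(w - u) + u‖ := by simp
      _ ≤ ‖w - u‖ + ‖u‖ := norm_add_le _ _
      _ < 3 / 2 := by linarith
  calc _ = ∫⁻ _ in Metric.ball u (1 / 2), ENNReal.ofReal (Real.exp (l * (‖T u‖ ^ 2 / 4))) := by
        rw [setLIntegral_const]
    _ ≤ ∫⁻ w in Metric.ball u (1 / 2), ENNReal.ofReal (Real.exp (l * ‖T w‖ ^ 2)) := by
        refine setLIntegral_mono
          (ENNReal.continuous_ofReal.comp (by fun_prop)).measurable fun w hw =>
            ENNReal.ofReal_le_ofReal ?_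
        rw [Metric.mem_ball, dist_eq_norm] at hw
        have h1 : ‖T u‖ ≤ ‖T w‖ + ‖T (w - u)‖ := by
          rw [map_sub, norm_sub_rev]
          calc ‖T u‖ = ‖T w + (T u - T w)‖ := by simp
            _ ≤ _ := norm_add_le _ _
        have h2 := (hM (w - u)).trans (mul_le_mul_of_nonneg_left hw.le (norm_nonneg _))
        have h3 : ‖T u‖ / 2 ≤ ‖T w‖ := by linarith
        have h4 := pow_le_pow_left₀ (by positivity) h3 2
        refine Real.exp_le_exp.2 (mul_le_mul_of_nonneg_left ?_ hl)
        linarith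
    _ ≤ _ := lintegral_mono_set hsub

/-- Allows the integration to run over ℝⁿ, so that the volume ratio is 3ⁿ and does not grow with p.
-/
lemma norm_toEuclideanLin_le_of_transpose {n p : ℕ} (N : Matrix (Fin n) (Fin p) ℝ) {M : ℝ}
    (hM : 0 ≤ M) (h : ∀ u, ‖Matrix.toEuclideanLin Nᵀ u‖ ≤ M * ‖u‖) (x : EuclideanSpace ℝ (Fin p)) :
    ‖Matrix.toEuclideanLin N x‖ ≤ M * ‖x‖ := by
  have hadj : Matrix.toEuclideanLin Nᵀ = (Matrix.toEuclideanLin N).adjoint := by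
    rw [← Matrix.toEuclideanLin_conjTranspose_eq_adjoint,
      Matrix.conjTranspose_eq_transpose_of_trivial]
  rw [hadj] at h
  set y := Matrix.toEuclideanLin N x with hy
  rcases eq_or_ne y 0 with h0 | h0
  · rw [h0, norm_zero]; positivity
  · have hy0 : 0 < ‖y‖ := norm_pos_iff.2 h0
    have h1 : ‖y‖ * ‖y‖ ≤ M * ‖x‖ * ‖y‖ := by
      calc ‖y‖ * ‖y‖ = inner ℝ x ((Matrix.toEuclideanLin N).adjoint y) := by
            rw [LinearMap.adjoint_inner_right, ← hy, real_inner_self_eq_norm_mul_norm]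
        _ ≤ ‖x‖ * ‖(Matrix.toEuclideanLin N).adjoint y‖ := real_inner_le_norm _ _
        _ ≤ ‖x‖ * (M * ‖y‖) := mul_le_mul_of_nonneg_left (h y) (norm_nonneg _)
        _ = _ := by ring
    exact le_of_mul_le_mul_right h1 hy0

end OperatorNorm

/-! ### Concentration of the operator and Frobenius norms -/

section Concentration

variable {Ω : Type*} [MeasurableSpace Ω] {P : Measure Ω} {n p : ℕ}
  {W : Fin n → Ω → Fin p → ℝ} {S : Matrix (Fin p) (Fin p) ℝ} {γ : ℝ}

/-- With probability at least `1 - exp (-n)`, the squared operator norm of the noise matrix is at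
most `108 γ² (n ‖S‖ + tr S)`. -/
theorem IsSubGaussianNoise.exists_opNorm_bound [IsProbabilityMeasure P]
    (h : IsSubGaussianNoise P W S γ) (hγ : 0 < γ) (hS : 0 < opNorm S) :
    ∃ B : Set Ω, P B ≤ ENNReal.ofReal (Real.exp (-n)) ∧ ∀ ω ∉ B, ∃ M : ℝ,
      0 ≤ M ∧ M ≤ 108 * γ ^ 2 * (n * opNorm S + S.trace) ∧
      ∀ x, ‖Matrix.toEuclideanLin (Matrix.of fun i => W i ω) x‖ ^ 2 ≤ M * ‖x‖ ^ 2 := by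
  set s := opNorm S with hs
  have htr : 0 ≤ S.trace := h.posSemidef.trace_nonneg
  -- On the ball ‖u‖² ≤ 9/4, so lγ²‖u‖²s ≤ 1/4 as decoupling requires.
  set l : ℝ := 1 / (9 * γ ^ 2 * s) with hl
  have hl0 : 0 < l := by positivity
  let D : Set (EuclideanSpace ℝ (Fin n)) := Metric.ball 0 (3 / 2)
  let f : Ω → EuclideanSpace ℝ (Fin n) → ENNReal := fun ω u =>
    ENNReal.ofReal (Real.exp (l * ∑ j, (∑ i, u i * W i ω j) ^ 2))
  have hmW : ∀ i j, Measurable fun ω => W i ω j := fun i j =>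
    (measurable_pi_apply j).comp (h.measurable i)
  have hf : Measurable (Function.uncurry f) := by
    have h1 : ∀ i j, Measurable fun z : Ω × EuclideanSpace ℝ (Fin n) => W i z.1 j := fun i j =>
      (hmW i j).comp measurable_fst
    have h2 : ∀ i, Measurable fun z : Ω × EuclideanSpace ℝ (Fin n) => z.2 i := fun i => by fun_prop
    simp only [Function.uncurry_def, f]
    fun_prop
  let G : Ω → ENNReal := fun ω => ∫⁻ u in D, f ω u
  have hG : Measurable G := hf.lintegral_prod_right
  set R : ℝ := S.trace / (2 * s) with hR
  have hfint : ∀ u ∈ D, ∫⁻ ω, f ω u ∂P ≤ ENNReal.ofReal (Real.exp R) := fun u hu => by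
    have hu1 : ‖u‖ ^ 2 ≤ 9 / 4 := by
      rw [mem_ball_zero_iff] at hu
      have := pow_le_pow_left₀ (norm_nonneg u) hu.le 2
      linarith
    rw [EuclideanSpace.real_norm_sq_eq] at hu1
    refine (h.lintegral_exp_sq_le (fun i => u i) hl0.le
      (eigenvalues_le_opNorm h.posSemidef.isHermitian) ?_).trans
      (ENNReal.ofReal_le_ofReal (Real.exp_le_exp.2 ?_))
    · calc l * (γ ^ 2 * (∑ i, u i ^ 2) * s) ≤ l * (γ ^ 2 * (9 / 4) * s) := by gcongr
        _ = 1 / 4 := by rw [hl]; field_simp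
    · calc 2 * l * (γ ^ 2 * (∑ i, u i ^ 2) * S.trace) ≤ 2 * l * (γ ^ 2 * (9 / 4) * S.trace) := by
            gcongr
        _ = R := by rw [hl, hR]; field_simp; norm_num
  have hGint : ∫⁻ ω, G ω ∂P ≤ ENNReal.ofReal (Real.exp R) * volume D := by
    rw [lintegral_lintegral_swap hf.aemeasurable]
    calc _ ≤ ∫⁻ _ in D, ENNReal.ofReal (Real.exp R) :=
          setLIntegral_mono measurable_const hfint
      _ = _ := setLIntegral_const _ _
  have hD0 : volume D ≠ 0 := (Metric.measure_ball_pos _ _ (by norm_num)).ne'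
  have hDt : volume D ≠ ⊤ := measure_ball_lt_top.ne
  -- Markov's level is eⁿ times the bound on the mean of `G`.
  set t : ENNReal := ENNReal.ofReal (Real.exp (R + n)) * volume D with ht
  have ht0 : t ≠ 0 := mul_ne_zero (by simp [Real.exp_pos]) hD0
  have htt : t ≠ ⊤ := ENNReal.mul_ne_top ENNReal.ofReal_ne_top hDt
  refine ⟨{ω | t ≤ G ω}, ?_, fun ω hω => ?_⟩
  · have hmk := (mul_meas_ge_le_lintegral (μ := P) hG t).trans hGint
    refine (ENNReal.mul_le_mul_iff_right ht0 htt).1 (hmk.trans (le_of_eq ?_))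
    rw [ht, mul_right_comm, ← ENNReal.ofReal_mul (Real.exp_pos _).le, ← Real.exp_add]
    congr 3; ring
  · simp only [Set.mem_ofPred_eq, not_le] at hω
    obtain ⟨M, hM0, hM, hMl⟩ := exists_norm_bound_of_lintegral_exp
      (Matrix.toEuclideanLin (Matrix.of fun i => W i ω)ᵀ) hl0.le
    have hfe : ∀ u : EuclideanSpace ℝ (Fin n), f ω u = ENNReal.ofReal (Real.exp
        (l * ‖Matrix.toEuclideanLin (Matrix.of fun i => W i ω)ᵀ u‖ ^ 2)) := fun u => by
      simp only [f, EuclideanSpace.real_norm_sq_eq]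
      congr 4
      ext j
      simp [Matrix.toLpLin_apply, Matrix.mulVec, dotProduct, mul_comm]
    have hlt : ENNReal.ofReal (Real.exp (l * (M ^ 2 / 4))) *
        volume (Metric.ball (0 : EuclideanSpace ℝ (Fin n)) (1 / 2)) < t := by
      refine hMl.trans_lt (lt_of_eq_of_lt ?_ hω)
      simp only [G, hfe, D]
    have hvol : volume D = ENNReal.ofReal (3 ^ n) *
        volume (Metric.ball (0 : EuclideanSpace ℝ (Fin n)) (1 / 2)) := by
      have := Measure.addHaar_ball_mul_of_pos (volume : Measure (EuclideanSpace ℝ (Fin n))) 0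
        (by norm_num : (0 : ℝ) < 3)
        (1 / 2)
      rw [finrank_euclideanSpace_fin] at this
      rw [← this]
      simp only [D]; norm_num
    rw [ht, hvol, ← mul_assoc, ENNReal.mul_lt_mul_iff_left
      (Metric.measure_ball_pos _ _ (by norm_num)).ne' measure_ball_lt_top.ne,
      ← ENNReal.ofReal_mul (Real.exp_pos _).le, ENNReal.ofReal_lt_ofReal_iff (by positivity)] at hlt
    have h3 : (3 : ℝ) ^ n ≤ Real.exp (2 * n) := by
      rw [mul_comm, Real.exp_nat_mul]
      refine pow_le_pow_left₀ (by norm_num) ?_ n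
      linarith [Real.add_one_le_exp (2 : ℝ)]
    have h4 : Real.exp (l * (M ^ 2 / 4)) < Real.exp (R + n + 2 * n) := by
      rw [Real.exp_add (R + n)]
      exact hlt.trans_le (mul_le_mul_of_nonneg_left h3 (Real.exp_pos _).le)
    rw [Real.exp_lt_exp, hl, hR, one_div_mul_eq_div, div_lt_iff₀ (by positivity)] at h4
    -- From lM²/4 < R + 3n one gets M² < 4γ²(27ns + (9/2) tr S); hence 108 = 4 · 27.
    have h5 : (S.trace / (2 * s) + n + 2 * n) * (9 * γ ^ 2 * s) =
        γ ^ 2 * (27 * (n * s) + 9 / 2 * S.trace) := by field_simp; ring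
    rw [h5] at h4
    refine ⟨M ^ 2, sq_nonneg _, ?_, fun x => ?_⟩
    · have : 0 ≤ γ ^ 2 * S.trace := by positivity
      linarith
    · rw [← mul_pow]
      exact pow_le_pow_left₀ (norm_nonneg _) (norm_toEuclideanLin_le_of_transpose _ hM0 hM x) 2

/-- With probability at least `1 - 256 γ⁴ / n`, the squared Frobenius norm of the noise matrix is
at least half its expectation. -/
theorem IsSubGaussianNoise.measure_frobSq_le [IsProbabilityMeasure P]
    (h : IsSubGaussianNoise P W S γ) (hγ : 0 < γ) (hn : 1 ≤ n) (htr : 0 < S.trace)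
    (hmem : ∀ i j, MemLp (fun ω => W i ω j) 2 P)
    (hcov : ∀ i j, ∫ ω, W i ω j ^ 2 ∂P = S j j) :
    P {ω | frobSq (Matrix.of fun i => W i ω) ≤ n * S.trace / 2} ≤
      ENNReal.ofReal (256 * γ ^ 4 / n) := by
  have hn' : (0 : ℝ) < n := by exact_mod_cast hn
  let Q : Fin n → Ω → ℝ := fun i ω => ∑ j, W i ω j ^ 2
  have hmW : ∀ i j, Measurable fun ω => W i ω j := fun i j =>
    (measurable_pi_apply j).comp (h.measurable i)
  have hQm : ∀ i, Measurable (Q i) := fun i => by simp only [Q]; fun_prop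
  have hQ0 : ∀ i ω, 0 ≤ Q i ω := fun i ω => Finset.sum_nonneg fun _ _ => sq_nonneg _
  -- Every eigenvalue is at most the trace, so the rate is admissible and the exponential moment of
  -- one row is at most e^(1/2) ≤ 2. With Q² ≤ (2/l²)e^(lQ) this gives the second moment 4/l² =
  -- 64γ⁴(tr S)².
  set l : ℝ := 1 / (4 * γ ^ 2 * S.trace) with hl
  have hl0 : 0 < l := by positivity
  have hsq : ∀ i, ∫⁻ ω, ENNReal.ofReal (Q i ω ^ 2) ∂P ≤
      ENNReal.ofReal (64 * γ ^ 4 * S.trace ^ 2) := fun i => by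
    have hu : ∑ k, (Pi.single i (1 : ℝ) : Fin n → ℝ) k ^ 2 = 1 := by
      simp [Pi.single_apply]
    have hexp := h.lintegral_exp_sq_le (Pi.single i 1) hl0.le
      (eigenvalues_le_trace h.posSemidef) (le_of_eq (by rw [hu, hl]; field_simp))
    have hrow : ∀ ω j, ∑ k, (Pi.single i (1 : ℝ) : Fin n → ℝ) k * W k ω j = W i ω j := fun ω j => by
      simp [Pi.single_apply]
    simp_rw [hrow] at hexp
    rw [hu] at hexp
    calc ∫⁻ ω, ENNReal.ofReal (Q i ω ^ 2) ∂P
        ≤ ∫⁻ ω, ENNReal.ofReal (2 / l ^ 2) * ENNReal.ofReal (Real.exp (l * Q i ω)) ∂P := by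
          refine lintegral_mono fun ω => ?_
          rw [← ENNReal.ofReal_mul (by positivity)]
          refine ENNReal.ofReal_le_ofReal ?_
          have h0 : 0 ≤ l * Q i ω := mul_nonneg hl0.le (hQ0 i ω)
          have h1 := Real.quadratic_le_exp_of_nonneg h0
          rw [div_mul_eq_mul_div, le_div_iff₀ (by positivity)]
          nlinarith
      _ = ENNReal.ofReal (2 / l ^ 2) * ∫⁻ ω, ENNReal.ofReal (Real.exp (l * Q i ω)) ∂P := by
          rw [lintegral_const_mul']
          exact ENNReal.ofReal_ne_top
      _ ≤ ENNReal.ofReal (2 / l ^ 2) *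
          ENNReal.ofReal (Real.exp (2 * l * (γ ^ 2 * 1 * S.trace))) := by gcongr
      _ ≤ _ := by
          rw [← ENNReal.ofReal_mul (by positivity)]
          refine ENNReal.ofReal_le_ofReal ?_
          have h1 : 2 * l * (γ ^ 2 * 1 * S.trace) = 1 / 2 := by
            rw [hl]; field_simp; norm_num
          have h2 : Real.exp (1 / 2) ≤ 2 := by
            have h3 : Real.exp (1 / 2) ^ 2 = Real.exp 1 := by
              rw [← Real.exp_nat_mul]; norm_num
            have h4 := Real.exp_one_lt_d9
            refine le_of_sq_le_sq ?_ (by norm_num)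
            rw [h3]; linarith
          rw [h1]
          calc 2 / l ^ 2 * Real.exp (1 / 2) ≤ 2 / l ^ 2 * 2 := by gcongr
            _ = _ := by rw [hl]; field_simp; norm_num
  have hQsqint : ∀ i, Integrable (fun ω => Q i ω ^ 2) P := fun i => by
    refine ⟨((hQm i).pow_const 2).aestronglyMeasurable, ?_⟩
    rw [hasFiniteIntegral_iff_ofReal (ae_of_all _ fun ω => sq_nonneg _)]
    exact (hsq i).trans_lt ENNReal.ofReal_lt_top
  have hQL2 : ∀ i, MemLp (Q i) 2 P := fun i =>
    (memLp_two_iff_integrable_sq (hQm i).aestronglyMeasurable).2 (hQsqint i)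
  have hQmean : ∀ i, ∫ ω, Q i ω ∂P = S.trace := fun i => by
    simp only [Q]
    rw [integral_finsetSum _ fun j _ => (hmem i j).integrable_sq]
    simp [hcov, Matrix.trace]
  have hQvar : ∀ i, variance (Q i) P ≤ 64 * γ ^ 4 * S.trace ^ 2 := fun i => by
    refine (variance_le_expectation_sq (hQm i).aestronglyMeasurable).trans ?_
    simp only [Pi.pow_apply]
    rw [integral_eq_lintegral_of_nonneg_ae (ae_of_all _ fun ω => sq_nonneg _)
      ((hQm i).pow_const 2).aestronglyMeasurable]
    exact ENNReal.toReal_le_of_le_ofReal (by positivity) (hsq i)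
  have hQindep : iIndepFun Q P :=
    h.indep.comp (fun _ w => ∑ j, w j ^ 2) fun _ => by fun_prop
  have hfrob : ∀ ω, frobSq (Matrix.of fun i => W i ω) = (∑ i, Q i) ω := fun ω => by
    simp [frobSq, Q]
  have hsumL2 : MemLp (∑ i, Q i) 2 P := memLp_finsetSum' _ fun i _ => hQL2 i
  have hmean : ∫ ω, (∑ i, Q i) ω ∂P = n * S.trace := by
    simp only [Finset.sum_apply]
    rw [integral_finsetSum _ fun i _ => (hQL2 i).integrable one_le_two]
    simp [hQmean]
  have hvar : variance (∑ i, Q i) P ≤ n * (64 * γ ^ 4 * S.trace ^ 2) := by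
    rw [IndepFun.variance_sum (fun i _ => hQL2 i) fun i _ j _ hij => hQindep.indepFun hij]
    calc _ ≤ ∑ i : Fin n, 64 * γ ^ 4 * S.trace ^ 2 := Finset.sum_le_sum fun i _ => hQvar i
      _ = _ := by simp
  have hcheb := meas_ge_le_variance_div_sq hsumL2 (c := n * S.trace / 2) (by positivity)
  refine (measure_mono fun ω hω => ?_).trans (hcheb.trans (ENNReal.ofReal_le_ofReal ?_))
  · simp only [Set.mem_ofPred_eq, hfrob] at hω ⊢
    rw [hmean, abs_sub_comm]
    refine le_trans ?_ (le_abs_self _)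
    linarith
  · calc _ ≤ n * (64 * γ ^ 4 * S.trace ^ 2) / (n * S.trace / 2) ^ 2 := by gcongr
      _ = _ := by field_simp; norm_num

end Concentration

/-! ### From the factor model to the spectral bounds -/

section Model

variable {Ω : Type*} [MeasurableSpace Ω] {P : Measure Ω} {n p K : ℕ}

open scoped MatrixOrder Matrix.Norms.L2Operator in
lemma posSemidef_matSqrt (S : Matrix (Fin p) (Fin p) ℝ) : (matSqrt S).PosSemidef :=
  Matrix.nonneg_iff_posSemidef.1 (CFC.sqrt_nonneg S)

open scoped MatrixOrder Matrix.Norms.L2Operator in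
lemma matSqrt_mul_self {S : Matrix (Fin p) (Fin p) ℝ} (hS : S.PosSemidef) :
    matSqrt S * matSqrt S = S :=
  CFC.sqrt_mul_sqrt_self S hS.nonneg

/-- The quadratic form at v is the second moment of ⟨v, w⟩. Positivity is what makes `matSqrt` a
genuine square root of the covariance. -/
lemma posSemidef_of_cov {w : Ω → Fin p → ℝ} {S : Matrix (Fin p) (Fin p) ℝ}
    (hmem : ∀ j, MemLp (fun ω => w ω j) 2 P) (hcov : ∀ j k, ∫ ω, w ω j * w ω k ∂P = S j k) :
    S.PosSemidef := by
  refine Matrix.PosSemidef.of_dotProduct_mulVec_nonneg ?_ fun v => ?_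
  · ext j k
    simp [← hcov, mul_comm]
  · have hint : ∀ j k, Integrable (fun ω => w ω j * w ω k) P := fun j k =>
      (hmem j).integrable_mul (hmem k)
    have h : star v ⬝ᵥ S *ᵥ v = ∫ ω, (v ⬝ᵥ w ω) ^ 2 ∂P := by
      have h1 : ∀ ω, (v ⬝ᵥ w ω) ^ 2 = ∑ j, ∑ k, v j * v k * (w ω j * w ω k) := fun ω => by
        rw [sq, dotProduct, Finset.sum_mul_sum]
        refine Finset.sum_congr rfl fun j _ => Finset.sum_congr rfl fun k _ => ?_
        ring
      simp_rw [h1]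
      rw [integral_finsetSum _ fun j _ => integrable_finsetSum _ fun k _ => (hint j k).const_mul _]
      simp only [dotProduct, Matrix.mulVec, star_trivial, Finset.mul_sum]
      refine Finset.sum_congr rfl fun j _ => ?_
      rw [integral_finsetSum _ fun k _ => (hint j k).const_mul _]
      refine Finset.sum_congr rfl fun k _ => ?_
      rw [integral_const_mul, hcov]
      ring
    rw [h]
    exact integral_nonneg fun ω => sq_nonneg _

/-- Normalizing v moves its length into the parameter t of the moment generating function; v = 0 is
trivial. -/
lemma IsSubGaussianVector.lintegral_exp_le [IsProbabilityMeasure P] {x : Ω → Fin p → ℝ} {γ : ℝ≥0}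
    (h : IsSubGaussianVector P x γ) (v : Fin p → ℝ) :
    ∫⁻ ω, ENNReal.ofReal (Real.exp (v ⬝ᵥ x ω)) ∂P ≤
      ENNReal.ofReal (Real.exp ((γ : ℝ) ^ 2 * (v ⬝ᵥ v) / 2)) := by
  rcases eq_or_ne v 0 with rfl | hv
  · simp
  have hpos : 0 < v ⬝ᵥ v := lt_of_le_of_ne
    (Finset.sum_nonneg fun i _ => mul_self_nonneg _)
    fun h0 => hv (dotProduct_self_eq_zero.1 h0.symm)
  set t := √(v ⬝ᵥ v) with ht
  have ht0 : 0 < t := Real.sqrt_pos.2 hpos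
  have ht2 : t ^ 2 = v ⬝ᵥ v := Real.sq_sqrt hpos.le
  have hsub := h.subGaussian (t⁻¹ • v) (by
    rw [smul_dotProduct, dotProduct_smul, ← ht2, smul_eq_mul, smul_eq_mul]
    field_simp)
  have heq : ∀ ω, v ⬝ᵥ x ω = t * ((t⁻¹ • v) ⬝ᵥ x ω) := fun ω => by
    rw [smul_dotProduct, smul_eq_mul, mul_inv_cancel_left₀ ht0.ne']
  simp_rw [heq]
  rw [← ofReal_integral_eq_lintegral_ofReal (hsub.integrable_exp_mul t)
    (ae_of_all _ fun ω => (Real.exp_pos _).le)]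
  refine ENNReal.ofReal_le_ofReal ((hsub.mgf_le t).trans (le_of_eq ?_))
  rw [ht2]; push_cast; rfl

lemma IsSGFRMSample.isSubGaussianNoise [IsProbabilityMeasure P] {θ : Param p K} {γz γw γε : ℝ≥0}
    {Z : Fin n → Ω → Fin K → ℝ} {W : Fin n → Ω → Fin p → ℝ} {ε : Fin n → Ω → ℝ}
    {X : Fin n → Ω → Fin p → ℝ} {Y : Fin n → Ω → ℝ} (hn : 1 ≤ n)
    (h : IsSGFRMSample P θ γz γw γε Z W ε X Y) : IsSubGaussianNoise P W θ.SigmaW γw where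
  measurable i := (h.model i).measurable_W
  indep := h.indep.comp (fun _ z => z.2.1) fun _ => by fun_prop
  posSemidef := posSemidef_of_cov (h.model ⟨0, hn⟩).memLp_W (h.model ⟨0, hn⟩).cov_W
  lintegral_exp_le i v := by
    have hS : θ.SigmaW.PosSemidef := posSemidef_of_cov (h.model i).memLp_W (h.model i).cov_W
    obtain ⟨Wt, hWt, -, hW⟩ := (h.model i).subGaussian_W
    have hsym : (matSqrt θ.SigmaW)ᵀ = matSqrt θ.SigmaW := by
      rw [← Matrix.conjTranspose_eq_transpose_of_trivial]
      exact (posSemidef_matSqrt _).isHermitian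
    have heq : ∫⁻ ω, ENNReal.ofReal (Real.exp (v ⬝ᵥ W i ω)) ∂P =
        ∫⁻ ω, ENNReal.ofReal (Real.exp ((matSqrt θ.SigmaW *ᵥ v) ⬝ᵥ Wt ω)) ∂P := by
      refine lintegral_congr_ae ?_
      filter_upwards [hW] with ω hω
      rw [hω, Matrix.dotProduct_mulVec, ← Matrix.mulVec_transpose, hsym]
    rw [heq]
    refine (hWt.lintegral_exp_le _).trans (le_of_eq ?_)
    have hdot : (matSqrt θ.SigmaW *ᵥ v) ⬝ᵥ (matSqrt θ.SigmaW *ᵥ v) = v ⬝ᵥ θ.SigmaW *ᵥ v := by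
      conv_rhs => rw [← matSqrt_mul_self hS, ← Matrix.mulVec_mulVec]
      rw [Matrix.dotProduct_mulVec v, ← Matrix.mulVec_transpose, hsym]
    rw [hdot]

/-- The selected rank and the neighbouring singular values, on the event where the noise matrix has
a small operator norm and a large Frobenius norm. -/
lemma IsRankSelector.lambdaHat_bounds {X L W : Matrix (Fin n) (Fin p) ℝ} (hX : X = L + W)
    (hL : L.rank ≤ K) {M : ℝ} (hM0 : 0 ≤ M)
    (hM : ∀ x, ‖Matrix.toEuclideanLin W x‖ ^ 2 ≤ M * ‖x‖ ^ 2) {κ c₀ c' cδ C₁ : ℝ} (hκ : 0 < κ)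
    (hc₀ : 0 < c₀) (hc' : 0 < c') (hcδ : 0 < cδ) (hC₁ : 0 < C₁)
    (hc₀' : 8 * C₁ * (1 / c' + 1) ≤ c₀) (hn : 1 ≤ n) (hp : 1 ≤ p)
    (hK : K ≤ Kbar n p κ (c₀ * (n + p))) {S : Matrix (Fin p) (Fin p) ℝ}
    (hMS : M ≤ C₁ * (n * opNorm S + S.trace)) (htr : 0 < S.trace)
    (heff : c' * min (n : ℝ) p * opNorm S ≤ S.trace) (hfrob : n * S.trace / 2 < frobSq W)
    {s : ℕ} (hs : IsRankSelector X κ (c₀ * (n + p)) s) :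
    s ≤ K ∧ ((c₀ / (4 * cδ * (1 / c' + 1)) * deltaW cδ n S : ℝ) : EReal) ≤ lambdaHat X s ∧
      lambdaHat X (s + 1) ≤ (((1 + 2 * (1 + κ) * c₀) * C₁ / cδ * deltaW cδ n S : ℝ) : EReal) := by
  have hn' : (0 : ℝ) < n := by exact_mod_cast hn
  have hp' : (0 : ℝ) < p := by exact_mod_cast hp
  set m := min (n : ℝ) p with hm
  have hm0 : 0 < m := lt_min hn' hp'
  set t := S.trace
  have hms : m * opNorm S ≤ t / c' := by
    rw [le_div_iff₀ hc']; linarith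
  have hnpm : (n : ℝ) * p ≤ (n + p) * m := by
    rcases min_choice (n : ℝ) p with h | h <;> rw [hm, h] <;> nlinarith
  have hmM : m * M ≤ C₁ * (1 / c' + 1) * (n * t) := by
    calc m * M ≤ m * (C₁ * (n * opNorm S + t)) := mul_le_mul_of_nonneg_left hMS hm0.le
      _ = C₁ * (n * (m * opNorm S) + m * t) := by ring
      _ ≤ C₁ * (n * (t / c') + n * t) := by
          gcongr
          exact min_le_left _ _
      _ = _ := by ring
  -- The threshold on c₀ arises here: the factor 4 of the gap condition doubles because ‖W‖_F² is
  -- only known to exceed half of n tr S.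
  have hgap : 4 * (n * p) * M < c₀ * (n + p) * frobSq W := by
    calc 4 * (n * p) * M ≤ 4 * ((n + p) * m) * M := by gcongr
      _ = 4 * (n + p) * (m * M) := by ring
      _ ≤ 4 * (n + p) * (C₁ * (1 / c' + 1) * (n * t)) := by gcongr
      _ = (8 * C₁ * (1 / c' + 1)) * (n + p) * (n * t / 2) := by ring
      _ ≤ c₀ * (n + p) * (n * t / 2) := by gcongr
      _ < _ := by gcongr
  obtain ⟨h1, h2, h3⟩ := hs.spec hX hL hM0 hM hκ hc₀ hn hp hK hgap
  refine ⟨h1, ?_, ?_⟩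
  · rcases eq_or_ne s 0 with rfl | hs0
    · simp [lambdaHat]
    rw [lambdaHat, if_neg hs0, EReal.coe_le_coe_iff, deltaW]
    have hlow : c₀ * (t / n + t / p) / 4 ≤ singVal X s ^ 2 / n := by
      have e : c₀ * (n + p) * (n * t / 2) ≤ 2 * (n * p) * singVal X s ^ 2 :=
        le_trans (by gcongr) (h2 hs0)
      rw [le_div_iff₀ hn']
      have e2 : c₀ * (t / n + t / p) / 4 * n = c₀ * (n + p) * (n * t / 2) / (2 * (n * p)) := by
        field_simp; ring
      rw [e2, div_le_iff₀ (by positivity)]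
      linarith
    refine le_trans ?_ hlow
    -- The effective rank condition combined with 1/(n ∧ p) ≤ 1/n + 1/p.
    have hinv : opNorm S ≤ 1 / c' * (t / n + t / p) := by
      have e : t / n + t / p = t * (n + p) / (n * p) := by field_simp; ring
      rw [e, div_mul_div_comm, one_mul, le_div_iff₀ (by positivity)]
      calc opNorm S * (c' * (n * p)) ≤ opNorm S * (c' * ((n + p) * m)) := by
            have : 0 ≤ opNorm S := norm_nonneg _
            gcongr
        _ = (c' * m * opNorm S) * (n + p) := by ring
        _ ≤ t * (n + p) := by gcongr
    have hsum : opNorm S + t / n ≤ (1 / c' + 1) * (t / n + t / p) := by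
      have : 0 ≤ t / p := by positivity
      linarith
    calc c₀ / (4 * cδ * (1 / c' + 1)) * (cδ * (opNorm S + t / n))
        ≤ c₀ / (4 * cδ * (1 / c' + 1)) * (cδ * ((1 / c' + 1) * (t / n + t / p))) := by gcongr
      _ = _ := by field_simp
  · rw [lambdaHat, if_neg (Nat.succ_ne_zero s), EReal.coe_le_coe_iff, deltaW, div_le_iff₀ hn']
    calc singVal X (s + 1) ^ 2 ≤ (1 + 2 * (1 + κ) * c₀) * M := h3
      _ ≤ (1 + 2 * (1 + κ) * c₀) * (C₁ * (n * opNorm S + t)) := by gcongr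
      _ = _ := by field_simp; rfl

end Model

end FactorRegression

/-! ### Choice of constants and union bound -/

theorem proposition2 (γw : ℝ≥0) (hγw : 0 < γw) (c' : ℝ) (hc' : 0 < c') :
    ∃ c₀min : ℝ, 0 < c₀min ∧ ∀ c₀ : ℝ, c₀min ≤ c₀ →
      ∀ κ : ℝ, 1 < κ → ∀ c : ℝ, 0 < c → ∀ cδ : ℝ, 0 < cδ →
      ∃ a b C : ℝ, 0 < a ∧ 0 < b ∧ 0 < C ∧
        ∀ (n p K : ℕ) (θ : FactorRegression.Param p K) (γz γε : ℝ≥0)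
          (Ω : Type*) [MeasurableSpace Ω] (P : Measure Ω) [IsProbabilityMeasure P]
          (Z : Fin n → Ω → Fin K → ℝ) (W : Fin n → Ω → Fin p → ℝ) (ε : Fin n → Ω → ℝ)
          (X : Fin n → Ω → Fin p → ℝ) (Y : Fin n → Ω → ℝ),
          1 ≤ n → 1 ≤ p →
          FactorRegression.IsSGFRMSample P θ γz γw γε Z W ε X Y →
          Real.log p ≤ c * n →
          K ≤ FactorRegression.Kbar n p κ (c₀ * (n + p)) →
          c' * min (n : ℝ) (p : ℝ) ≤ FactorRegression.effRank θ.SigmaW →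
          1 - C / n ≤ P.real {ω | ∀ s : ℕ,
            FactorRegression.IsRankSelector (Matrix.of fun i => X i ω) κ (c₀ * (n + p)) s →
              s ≤ K ∧
              ((a * FactorRegression.deltaW cδ n θ.SigmaW : ℝ) : EReal) ≤
                FactorRegression.lambdaHat (Matrix.of fun i => X i ω) s ∧
              FactorRegression.lambdaHat (Matrix.of fun i => X i ω) (s + 1) ≤
                ((b * FactorRegression.deltaW cδ n θ.SigmaW : ℝ) : EReal)} := by
  have hγ : (0 : ℝ) < γw := by exact_mod_cast hγw
  have hmin : 0 < 8 * (108 * (γw : ℝ) ^ 2) * (1 / c' + 1) := by positivity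
  refine ⟨_, hmin, fun c₀ hc₀ κ hκ c _ cδ hcδ => ?_⟩
  have hc₀0 : 0 < c₀ := hmin.trans_le hc₀
  refine ⟨c₀ / (4 * cδ * (1 / c' + 1)), (1 + 2 * (1 + κ) * c₀) * (108 * (γw : ℝ) ^ 2) / cδ,
    256 * (γw : ℝ) ^ 4 + 1, by positivity, by positivity, by positivity, ?_⟩
  intro n p K θ γz γε Ω _ P _ Z W ε X Y hn hp hmodel _ hK heff
  have hn' : (0 : ℝ) < n := by exact_mod_cast hn
  have hp' : (0 : ℝ) < p := by exact_mod_cast hp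
  have hnoise := hmodel.isSubGaussianNoise hn
  have heff0 : 0 < FactorRegression.effRank θ.SigmaW :=
    (mul_pos hc' (lt_min hn' hp')).trans_le heff
  -- Division by zero gives Σ_W = 0 effective rank 0, which the positive lower bound excludes.
  have hop : 0 < FactorRegression.opNorm θ.SigmaW := by
    refine (norm_nonneg _).lt_of_ne fun h0 => ?_
    rw [FactorRegression.effRank, FactorRegression.opNorm, ← h0, div_zero] at heff0
    exact heff0.false
  have htr : 0 < θ.SigmaW.trace := (div_pos_iff_of_pos_right hop).1 heff0
  rw [FactorRegression.effRank, le_div_iff₀ hop] at heff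
  obtain ⟨B, hB, hBM⟩ := hnoise.exists_opNorm_bound hγ hop
  have hF := hnoise.measure_frobSq_le hγ hn htr (fun i => (hmodel.model i).memLp_W)
    (fun i j => by simpa [sq] using (hmodel.model i).cov_W j j)
  set F := {ω | FactorRegression.frobSq (Matrix.of fun i => W i ω) ≤ n * θ.SigmaW.trace / 2}
  have hBF : P.real (B ∪ F) ≤ (256 * (γw : ℝ) ^ 4 + 1) / n := by
    have h1 : P.real B ≤ 1 / n := by
      refine (ENNReal.toReal_le_of_le_ofReal (Real.exp_pos _).le hB).trans ?_
      rw [Real.exp_neg, ← one_div]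
      exact one_div_le_one_div_of_le hn' (by linarith [Real.add_one_le_exp (n : ℝ)])
    have h2 : P.real F ≤ 256 * (γw : ℝ) ^ 4 / n :=
      ENNReal.toReal_le_of_le_ofReal (by positivity) hF
    rw [add_div]
    linarith [measureReal_union_le (μ := P) B F]
  -- Subadditivity suffices here, so B need not be measurable.
  have hcompl : 1 - P.real (B ∪ F) ≤ P.real (B ∪ F)ᶜ := by
    have := measureReal_union_le (μ := P) (B ∪ F) (B ∪ F)ᶜ
    rw [Set.union_compl_self, probReal_univ] at this
    linarith
  refine (sub_le_sub_left hBF 1).trans (hcompl.trans (measureReal_mono ?_))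
  intro ω hω s hs
  rw [Set.mem_compl_iff, Set.mem_union, not_or] at hω
  obtain ⟨M, hM0, hMle, hM⟩ := hBM ω hω.1
  have hfrob : n * θ.SigmaW.trace / 2 < FactorRegression.frobSq (Matrix.of fun i => W i ω) := by
    simpa only [F, Set.mem_ofPred_eq, not_le] using hω.2
  have hX : (Matrix.of fun i => X i ω) =
      (Matrix.of fun i => Z i ω) * θ.Aᵀ + Matrix.of fun i => W i ω := by
    ext i j
    rw [Matrix.of_apply, (hmodel.model i).X_eq ω]
    simp [Matrix.mul_apply, Matrix.mulVec, dotProduct, mul_comm]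
  exact hs.lambdaHat_bounds hX ((Matrix.rank_mul_le_left _ _).trans (Matrix.rank_le_width _))
    hM0 hM (by linarith) hc₀0 hc' hcδ (by positivity) hc₀ hn hp hK hMle htr heff hfrob
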